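/- **Theorem 2.8 (Conservation laws).** Let $T\in(0,\infty]$, let $\Omega(t)\subset\mathbb R^3$ ($0\le t<T$) be bounded $C^2$-domains with unit outer normal $n=n(x,t)$ on $\partial\Omega(t)$, and let $e_1,\dots,e_5$ be real $C^1$-functions, $e_j'=de_j/dr$. Let $\rho,\sigma,e,\theta,C$ (scalar) and $v,F$ ($\mathbb R^3$-valued) be functions of $(x,t)$. Write $D_tf=\partial_tf+(v,\nabla)f$, $[\nabla v]_{ij}=\partial_jv_i$, $D_\pm(v)=\frac12\{\nabla v\pm{}^t(\nabla v)\}$, $|M|^2=\sum_{i,j}M_{ij}^2$ and $(\operatorname{div}M)_i=\sum_j\partial_jM_{ij}$ for a matrix $M$, and $$S(v,\sigma)=e_1'(|D_+(v)|^2)D_+(v)+e_2'(|\operatorname{div}v|^2)(\operatorname{div}v)I_3+e_3'(|D_-(v)|^2)D_-(v)-\sigma I_3,$$ $$\tilde e_D=e_1'(|D_+(v)|^2)|D_+(v)|^2+e_2'(|\operatorname{div}v|^2)|\operatorname{div}v|^2+e_3'(|D_-(v)|^2)|D_-(v)|^2,$$ $$q_\theta=e_4'(|\operatorname{grad}\theta|^2)\operatorname{grad}\theta,\qquad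 q_C=e_5'(|\operatorname{grad}C|^2)\operatorname{grad}C,\qquad e_A=\tfrac12\rho|v|^2+\rho e.$$ Assume smoothness: for $0<t<T$ the functions $\rho,v,\sigma,e,\theta,C,F$ are jointly $C^1$ in a neighbourhood of each point $(x,t)$ with $x\in\overline{\Omega(t)}$, and in $\Omega(t)$ the velocity $v$ is $C^2$ in $x$ and $S(v,0)$, $q_\theta$, $q_C$ are $C^1$ in $x$. Assume that $\Omega(t)$ is flowed by $v$: there is a map $\tilde x(\xi,t)\in\mathbb R^3$, $C^2$ in a neighbourhood of each point of $\overline{\Omega(0)}\times[0,T)$, such that for every $\xi\in\Omega(0)$ we have $\tilde x(\xi,0)=\xi$ and $\frac{d\tilde x}{dt}(\xi,t)=v(\tilde x(\xi,t),t)$ for $0<t<T$, and such that $\tilde x(\cdot,t):\Omega(0)\to\Omega(t)$ is bijective for $0\le t<T$. Assume finally that for all $0<t<T$ and $x\in\Omega(t)$ $$\begin{cases}D_t\rho+(\operatorname{div}v)\rho=0,\\ \rho D_tv+\operatorname{grad}\sigma=\operatorname{div}S(v,0)+\rho F,\\ \rho D_te+(\operatorname{div}v)\sigma=\operatorname{div}q_\theta+\tilde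 e_D,\\ D_tC+(\operatorname{div}v)C=\operatorname{div}q_C.\end{cases}\tag{1.1}$$ Then the following two assertions hold. (i) Assume that for each $0<t<T$, on $\partial\Omega(t)$, $$e_4'(|\operatorname{grad}\theta|^2)(n,\nabla)\theta=0,\qquad e_5'(|\operatorname{grad}C|^2)(n,\nabla)C=0,\qquad S(v,\sigma)\,n=0.$$ Then for all $0<t_1<t_2<T$ $$\int_{\Omega(t_2)}\rho v\,dx=\int_{\Omega(t_1)}\rho v\,dx+\int_{t_1}^{t_2}\!\int_{\Omega(\tau)}\rho F\,dx\,d\tau,$$ $$\int_{\Omega(t_2)}e_A\,dx=\int_{\Omega(t_1)}e_A\,dx+\int_{t_1}^{t_2}\!\int_{\Omega(\tau)}\rho F\cdot v\,dx\,d\tau,\qquad \int_{\Omega(t_2)}C\,dx=\int_{\Omega(t_1)}C\,dx.$$ (ii) Assume that $e_3(r)=\mu_3r$ for all $r\ge0$, for some $\mu_3\in\mathbb R$, and that for each $0<t<T$, on $\partial\Omega(t)$, $$\big[(e_1'(|D_+(v)|^2)+\mu_3)D_+(v)+(e_2'(|\operatorname{div}v|^2)-\mu_3)(\operatorname{div}v)I_3-\sigma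 I_3\big]n=0.$$ Then for all $0<t_1<t_2<T$ $$\int_{\Omega(t_2)}x\times\rho v\,dx=\int_{\Omega(t_1)}x\times\rho v\,dx+\int_{t_1}^{t_2}\!\int_{\Omega(\tau)}x\times\rho F\,dx\,d\tau.$$ -/

import Mathlib

open MeasureTheory Topology

noncomputable section

namespace NonNewtonianFluid

/-- Three-dimensional Euclidean space. -/
abbrev E3 : Type := EuclideanSpace ℝ (Fin 3)

/-! ### Bounded domains of class `C²` and their outer normals -/

/-- `φ` is a `C²` defining function of `Ω` near the point `x₀`: it has a non-vanishing gradient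
at `x₀`, and near `x₀` the set `Ω` is exactly the side where `φ` is negative. -/
structure IsLocalDefiningFunction (Ω : Set E3) (x₀ : E3) (φ : E3 → ℝ) : Prop where
  contDiffAt : ContDiffAt ℝ 2 φ x₀
  gradient_ne_zero : gradient φ x₀ ≠ 0
  mem_iff : ∀ᶠ y in 𝓝 x₀, (y ∈ Ω ↔ φ y < 0)

/-- A bounded `C²`-domain: a bounded, nonempty, connected open set which near each of its boundary
points lies on one side of a regular level set of a `C²` function. -/
structure IsBoundedDomainOfClassTwo (Ω : Set E3) : Prop where
  isOpen : IsOpen Ω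
  isConnected : IsConnected Ω
  isBounded : Bornology.IsBounded Ω
  exists_definingFunction : ∀ x₀ ∈ frontier Ω, ∃ φ : E3 → ℝ, IsLocalDefiningFunction Ω x₀ φ

/-- `n` is the unit outer normal vector of `Ω` at the boundary point `x`, that is the normalized
gradient of a defining function that is negative inside `Ω`. (It does not depend on the choice of
the defining function.) -/
def IsUnitOuterNormal (Ω : Set E3) (x n : E3) : Prop :=
  x ∈ frontier Ω ∧ ∃ φ : E3 → ℝ, IsLocalDefiningFunction Ω x φ ∧
    n = ‖gradient φ x‖⁻¹ • gradient φ x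

/-! ### Vector calculus in the space variables -/

/-- The partial derivative `∂ᵢ f` at `x`. -/
def pderiv (i : Fin 3) (f : E3 → ℝ) (x : E3) : ℝ :=
  fderiv ℝ f x (EuclideanSpace.single i 1)

/-- The divergence `∑ᵢ ∂ᵢ uᵢ` of a vector field. -/
def divergence (u : E3 → E3) (x : E3) : ℝ :=
  ∑ i, pderiv i (fun y => u y i) x

/-- The divergence of a matrix field, taken along rows: `(div M)ᵢ = ∑ⱼ ∂ⱼ Mᵢⱼ`. -/
def matrixDivergence (M : E3 → Matrix (Fin 3) (Fin 3) ℝ) (x : E3) : E3 :=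
  WithLp.toLp 2 fun i => ∑ j, pderiv j (fun y => M y i j) x

/-- The velocity gradient, `(∇u)ᵢⱼ = ∂ⱼ uᵢ`. -/
def velocityGradient (u : E3 → E3) (x : E3) : Matrix (Fin 3) (Fin 3) ℝ :=
  Matrix.of fun i j => pderiv j (fun y => u y i) x

/-- The strain rate tensor `D₊(u) = (∇u + ᵗ∇u) / 2`. -/
def strainRate (u : E3 → E3) (x : E3) : Matrix (Fin 3) (Fin 3) ℝ :=
  (1 / 2 : ℝ) • (velocityGradient u x + (velocityGradient u x).transpose)

/-- The vorticity tensor `D₋(u) = (∇u - ᵗ∇u) / 2`. -/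
def vorticity (u : E3 → E3) (x : E3) : Matrix (Fin 3) (Fin 3) ℝ :=
  (1 / 2 : ℝ) • (velocityGradient u x - (velocityGradient u x).transpose)

/-- `|M|² = M : M = ∑ᵢⱼ Mᵢⱼ Mᵢⱼ`. -/
def matrixNormSq (M : Matrix (Fin 3) (Fin 3) ℝ) : ℝ :=
  ∑ i, ∑ j, M i j * M i j

/-- The product `M n` of a matrix and a vector. -/
def applyMatrix (M : Matrix (Fin 3) (Fin 3) ℝ) (n : E3) : E3 :=
  WithLp.toLp 2 (M.mulVec n.ofLp)

/-- The cross product of two vectors. -/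
def cross (x y : E3) : E3 :=
  WithLp.toLp 2 (crossProduct x.ofLp y.ofLp)

/-! ### The fluid -/

/-- The `C¹` functions `e₁, …, e₅` of one real variable that determine the energy densities.
(They are only evaluated on `[0, ∞)`; every `C¹` function on `[0, ∞)` extends to such a function.) -/
structure EnergyDensities where
  e₁ : ℝ → ℝ
  e₂ : ℝ → ℝ
  e₃ : ℝ → ℝ
  e₄ : ℝ → ℝ
  e₅ : ℝ → ℝ
  contDiff₁ : ContDiff ℝ 1 e₁
  contDiff₂ : ContDiff ℝ 1 e₂
  contDiff₃ : ContDiff ℝ 1 e₃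
  contDiff₄ : ContDiff ℝ 1 e₄
  contDiff₅ : ContDiff ℝ 1 e₅

/-- The unknowns and the force, as functions of the time (first argument) and the position: density,
velocity, pressure, internal energy, temperature, concentration, and exterior force. -/
structure FluidFields where
  ρ : ℝ → E3 → ℝ
  v : ℝ → E3 → E3
  σ : ℝ → E3 → ℝ
  e : ℝ → E3 → ℝ
  θ : ℝ → E3 → ℝ
  C : ℝ → E3 → ℝ
  F : ℝ → E3 → E3

/-- The stress tensor
`S(u, p) = e₁'(|D₊u|²) D₊u + e₂'(|div u|²) (div u) I + e₃'(|D₋u|²) D₋u - p I`. -/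
def stress (E : EnergyDensities) (u : E3 → E3) (p : E3 → ℝ) (x : E3) :
    Matrix (Fin 3) (Fin 3) ℝ :=
  deriv E.e₁ (matrixNormSq (strainRate u x)) • strainRate u x
    + (deriv E.e₂ (|divergence u x| ^ 2) * divergence u x) • (1 : Matrix (Fin 3) (Fin 3) ℝ)
    + deriv E.e₃ (matrixNormSq (vorticity u x)) • vorticity u x
    - p x • (1 : Matrix (Fin 3) (Fin 3) ℝ)

/-- The modified, symmetric stress tensor
`(e₁'(|D₊u|²) + μ) D₊u + (e₂'(|div u|²) - μ) (div u) I - p I`. -/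
def modifiedStress (E : EnergyDensities) (μ : ℝ) (u : E3 → E3) (p : E3 → ℝ) (x : E3) :
    Matrix (Fin 3) (Fin 3) ℝ :=
  (deriv E.e₁ (matrixNormSq (strainRate u x)) + μ) • strainRate u x
    + ((deriv E.e₂ (|divergence u x| ^ 2) - μ) * divergence u x) •
        (1 : Matrix (Fin 3) (Fin 3) ℝ)
    - p x • (1 : Matrix (Fin 3) (Fin 3) ℝ)

/-- The density for the energy dissipation due to the viscosities,
`e₁'(|D₊u|²) |D₊u|² + e₂'(|div u|²) |div u|² + e₃'(|D₋u|²) |D₋u|²`. -/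
def dissipation (E : EnergyDensities) (u : E3 → E3) (x : E3) : ℝ :=
  deriv E.e₁ (matrixNormSq (strainRate u x)) * matrixNormSq (strainRate u x)
    + deriv E.e₂ (|divergence u x| ^ 2) * |divergence u x| ^ 2
    + deriv E.e₃ (matrixNormSq (vorticity u x)) * matrixNormSq (vorticity u x)

/-- The flux `a'(|grad f|²) grad f`: the heat flux for `a = e₄`, `f = θ`, and the general flux
for `a = e₅`, `f = C`. -/
def flux (a : ℝ → ℝ) (f : E3 → ℝ) (x : E3) : E3 :=
  deriv a (‖gradient f x‖ ^ 2) • gradient f x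

/-- The material derivative `D_t f = ∂_t f + (v, ∇) f` of a scalar or vector valued function at
time `t` and position `x`. -/
def materialDeriv {G : Type*} [NormedAddCommGroup G] [NormedSpace ℝ G]
    (v : ℝ → E3 → E3) (f : ℝ → E3 → G) (t : ℝ) (x : E3) : G :=
  deriv (fun s => f s x) t + fderiv ℝ (f t) x (v t x)

/-- The total energy `e_A = ρ |v|² / 2 + ρ e`. -/
def totalEnergy (f : FluidFields) (t : ℝ) (x : E3) : ℝ :=
  f.ρ t x * ‖f.v t x‖ ^ 2 / 2 + f.ρ t x * f.e t x

/-- `g` is of class `C¹` up to the boundary of the moving domain: at every time in `(0, T)`, it is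
jointly `C¹` in a neighbourhood of every point of the closed domain. -/
def IsSmoothOnTube {G : Type*} [NormedAddCommGroup G] [NormedSpace ℝ G]
    (T : EReal) (Ω : ℝ → Set E3) (g : ℝ → E3 → G) : Prop :=
  ∀ t : ℝ, 0 < t → (t : EReal) < T → ∀ x ∈ closure (Ω t),
    ContDiffAt ℝ 1 (Function.uncurry g) (t, x)

/-- The standing smoothness of the fluid: all fields are `C¹` up to the boundary, and the terms
which the system differentiates once more are `C¹` inside, that is, the velocity is `C²` in the
space variables and `S(v, 0)` and the two fluxes are `C¹` in the space variables. -/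
structure IsClassical (T : EReal) (Ω : ℝ → Set E3) (E : EnergyDensities)
    (f : FluidFields) : Prop where
  ρ_smooth : IsSmoothOnTube T Ω f.ρ
  v_smooth : IsSmoothOnTube T Ω f.v
  σ_smooth : IsSmoothOnTube T Ω f.σ
  e_smooth : IsSmoothOnTube T Ω f.e
  θ_smooth : IsSmoothOnTube T Ω f.θ
  C_smooth : IsSmoothOnTube T Ω f.C
  F_smooth : IsSmoothOnTube T Ω f.F
  v_space : ∀ t : ℝ, 0 < t → (t : EReal) < T → ∀ x ∈ Ω t, ContDiffAt ℝ 2 (f.v t) x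
  stress_space : ∀ t : ℝ, 0 < t → (t : EReal) < T → ∀ x ∈ Ω t, ∀ i j : Fin 3,
    ContDiffAt ℝ 1 (fun y => stress E (f.v t) (fun _ => 0) y i j) x
  heatFlux_space : ∀ t : ℝ, 0 < t → (t : EReal) < T → ∀ x ∈ Ω t,
    ContDiffAt ℝ 1 (flux E.e₄ (f.θ t)) x
  generalFlux_space : ∀ t : ℝ, 0 < t → (t : EReal) < T → ∀ x ∈ Ω t,
    ContDiffAt ℝ 1 (flux E.e₅ (f.C t)) x

/-- The generalized compressible non-Newtonian fluid system in the space-time domain. -/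
structure SolvesSystem (T : EReal) (Ω : ℝ → Set E3) (E : EnergyDensities)
    (f : FluidFields) : Prop where
  mass : ∀ t : ℝ, 0 < t → (t : EReal) < T → ∀ x ∈ Ω t,
    materialDeriv f.v f.ρ t x + divergence (f.v t) x * f.ρ t x = 0
  momentum : ∀ t : ℝ, 0 < t → (t : EReal) < T → ∀ x ∈ Ω t,
    f.ρ t x • materialDeriv f.v f.v t x + gradient (f.σ t) x
      = matrixDivergence (stress E (f.v t) (fun _ => 0)) x + f.ρ t x • f.F t x
  energy : ∀ t : ℝ, 0 < t → (t : EReal) < T → ∀ x ∈ Ω t,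
    f.ρ t x * materialDeriv f.v f.e t x + divergence (f.v t) x * f.σ t x
      = divergence (flux E.e₄ (f.θ t)) x + dissipation E (f.v t) x
  concentration : ∀ t : ℝ, 0 < t → (t : EReal) < T → ∀ x ∈ Ω t,
    materialDeriv f.v f.C t x + divergence (f.v t) x * f.C t x
      = divergence (flux E.e₅ (f.C t)) x

/-- `Ω(t)` is flowed by the velocity `v`: there is a flow map `X = X(t, ξ)`, smooth (`C²`) up to the
boundary of `Ω(0)`, whose orbits start at `ξ` and follow `v`, and which maps `Ω(0)` bijectively onto
`Ω(t)`. -/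
def IsFlowedBy (T : EReal) (Ω : ℝ → Set E3) (v : ℝ → E3 → E3) : Prop :=
  ∃ X : ℝ → E3 → E3,
    (∀ t : ℝ, 0 ≤ t → (t : EReal) < T → ∀ ξ ∈ closure (Ω 0),
      ContDiffAt ℝ 2 (Function.uncurry X) (t, ξ)) ∧
    (∀ ξ ∈ Ω 0, X 0 ξ = ξ) ∧
    (∀ t : ℝ, 0 < t → (t : EReal) < T → ∀ ξ ∈ Ω 0,
      HasDerivAt (fun s => X s ξ) (v t (X t ξ)) t) ∧
    (∀ t : ℝ, 0 ≤ t → (t : EReal) < T → Set.BijOn (X t) (Ω 0) (Ω t))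

end NonNewtonianFluid

end

open NonNewtonianFluid

/-!
The balance laws hold because the system is in divergence form along the flow, and because the
boundary conditions make every flux tangent to the boundary.

Pulled back to `Ω(0)` by the flow map `X`, the integral of `g` over `Ω(t)` is the integral of
`|J| g(t, X)`, where `J = det DX`. Along an orbit, `|J|` satisfies `∂ₜ |J| = (div v) |J|`
(`hasDerivAt_abs_det_flow`), so that the fundamental theorem of calculus, Fubini's theorem and a
change of variables yield the transport theorem `integral_transport`: the integral of `g` grows at
the rate `∫ (D_t g + (div v) g)`. Neither a differentiation under the integral sign nor the sign of
`J` is needed.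

For `g = ρ v`, `e_A`, `C` and `x × ρ v`, the system turns `D_t g + (div v) g` into a divergence
plus the density of the force term (`momentum_balance`, `energy_balance`,
`angular_momentum_balance`). For the energy this uses `S : ∇v = ẽ_D - σ div v`. For the angular
momentum, `S` is first replaced by the modified stress tensor: the two differ by a multiple of the
divergence free field `ᵗ(∇v) - (div v) I`, and the modified tensor is symmetric, so that
`x × div M = div (x × M)`.

The integrals of these divergences vanish by `setIntegral_divergence_eq_zero`. The fluxes are `C¹`
only inside the domain and continuous up to its boundary, but their divergences are bounded, as the
system expresses them through functions that are continuous up to the boundary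
(`integral_balance`). As the fluxes are tangent to the boundary, no surface integral appears: a
cut-off near the boundary costs a gradient of size `1 / ε` on a layer of volume `O(ε)`
(`exists_measure_layer_le`), and this gradient is paired with the normal component of the flux,
which is small there.
-/

open NonNewtonianFluid

namespace NonNewtonianFluid

open Set Filter Metric
open scoped ContDiff Manifold

/-! ### Products and divergences -/

theorem pderiv_apply {u : E3 → E3} {x : E3} (hu : DifferentiableAt ℝ u x) (i j : Fin 3) :
    pderiv j (fun y => u y i) x = fderiv ℝ u x (EuclideanSpace.single j 1) i := by
  have h : HasFDerivAt (fun y => u y i)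
      ((PiLp.proj (𝕜 := ℝ) 2 (fun _ : Fin 3 => ℝ) i).comp (fderiv ℝ u x)) x :=
    (PiLp.proj (𝕜 := ℝ) 2 (fun _ : Fin 3 => ℝ) i).hasFDerivAt.comp x hu.hasFDerivAt
  rw [pderiv, h.fderiv]
  rfl

theorem divergence_eq {u : E3 → E3} {x : E3} (hu : DifferentiableAt ℝ u x) :
    divergence u x = ∑ i, fderiv ℝ u x (EuclideanSpace.single i 1) i := by
  simp only [divergence, pderiv_apply hu]

theorem divergence_congr {u w : E3 → E3} {x : E3} (h : u =ᶠ[𝓝 x] w) :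
    divergence u x = divergence w x := by
  unfold divergence pderiv
  refine Finset.sum_congr rfl fun i _ => ?_
  have hi : (fun y => u y i) =ᶠ[𝓝 x] fun y => w y i := h.mono fun y hy => by simp [hy]
  rw [hi.fderiv_eq]

theorem sum_coord_smul_single (a : E3) :
    ∑ i, a i • (EuclideanSpace.single i (1 : ℝ) : E3) = a := by
  have := (EuclideanSpace.basisFun (Fin 3) ℝ).sum_repr a
  simpa using this

theorem sum_coord_mul_apply (L : E3 →L[ℝ] ℝ) (a : E3) :
    ∑ i, a i * L (EuclideanSpace.single i 1) = L a := by
  conv_rhs => rw [← sum_coord_smul_single a, map_sum]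
  simp

theorem divergence_smul {χ : E3 → ℝ} {u : E3 → E3} {x : E3} (hχ : DifferentiableAt ℝ χ x)
    (hu : DifferentiableAt ℝ u x) :
    divergence (fun y => χ y • u y) x = χ x * divergence u x + fderiv ℝ χ x (u x) := by
  rw [divergence_eq (hχ.fun_smul hu), divergence_eq hu, ← sum_coord_mul_apply, Finset.mul_sum,
    ← Finset.sum_add_distrib]
  refine Finset.sum_congr rfl fun i _ => ?_
  rw [fderiv_fun_smul hχ hu]
  simp [mul_comm]

theorem continuousOn_divergence {Ω : Set E3} (hΩ : IsOpen Ω) {u : E3 → E3}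
    (hu : ContDiffOn ℝ 1 u Ω) : ContinuousOn (divergence u) Ω := by
  have h := hu.continuousOn_fderiv_of_isOpen hΩ le_rfl
  have : ContinuousOn (fun x => ∑ i, fderiv ℝ u x (EuclideanSpace.single i 1) i) Ω := by
    refine continuousOn_finsetSum _ fun i _ => ?_
    exact (PiLp.proj (𝕜 := ℝ) 2 (fun _ : Fin 3 => ℝ) i).continuous.comp_continuousOn
      (h.clm_apply continuousOn_const)
  refine this.congr fun x hx => divergence_eq ?_
  exact (hu.contDiffAt (hΩ.mem_nhds hx)).differentiableAt one_ne_zero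

/-! ### The divergence theorem for fields tangent to the boundary -/

theorem integral_divergence_eq_zero_of_hasCompactSupport {u : E3 → E3} (hu : ContDiff ℝ 1 u)
    (hc : HasCompactSupport u) : ∫ x, divergence u x = 0 := by
  have hi : ∀ i : Fin 3, ContDiff ℝ 1 (fun x => u x i) := fun i => contDiff_euclidean.1 hu i
  have hci : ∀ i : Fin 3, HasCompactSupport (fun x => u x i) := fun i =>
    hc.comp_left (g := fun z : E3 => z i) (by simp)
  have hcont : ∀ i : Fin 3, Continuous fun x => pderiv i (fun y => u y i) x := fun i =>
    ((hi i).continuous_fderiv one_ne_zero).clm_apply continuous_const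
  have hint : ∀ i : Fin 3, Integrable fun x => pderiv i (fun y => u y i) x := fun i =>
    (hcont i).integrable_of_hasCompactSupport
      (((hci i).fderiv ℝ).comp_left (g := fun L : E3 →L[ℝ] ℝ => L (EuclideanSpace.single i 1))
        (by simp))
  unfold divergence
  rw [integral_finsetSum _ fun i _ => hint i]
  refine Finset.sum_eq_zero fun i _ => ?_
  have h := integral_mul_fderiv_eq_neg_fderiv_mul_of_integrable (𝕜 := ℝ)
    (μ := (volume : Measure E3)) (f := fun _ => (1 : ℝ)) (g := fun x => u x i)
    (v := EuclideanSpace.single i 1) (by simp)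
    (by simpa [pderiv] using hint i)
    (by simpa using (hi i).continuous.integrable_of_hasCompactSupport (hci i))
    (fun _ _ => differentiableAt_const _)
    (fun x _ => (hi i).differentiable one_ne_zero x)
  simpa [pderiv] using h

/-- The region where a function lies between `-ε` and `ε` has measure `O(ε)` in a ball in which the
function increases at a definite rate along some direction: about `1 / ε` translates of this region
in that direction are pairwise disjoint and stay in a fixed ball. -/
theorem exists_measure_layer_le {V : Type*} [NormedAddCommGroup V] [NormedSpace ℝ V]
    [FiniteDimensional ℝ V] [MeasurableSpace V] [BorelSpace V] (μ : Measure V)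
    [μ.IsAddHaarMeasure] {φ : V → ℝ} {x₀ d : V} {r c : ℝ} (hc : 0 < c)
    (hφ : ∀ x ∈ ball x₀ r, DifferentiableAt ℝ φ x)
    (hφd : ∀ x ∈ ball x₀ r, c ≤ fderiv ℝ φ x d) :
    ∃ K : ℝ, 0 ≤ K ∧ ∀ ε : ℝ, 0 < ε →
      μ (ball x₀ r ∩ φ ⁻¹' Ioo (-ε) ε) ≤ ENNReal.ofReal (K * ε) := by
  have hmono : ∀ y ∈ ball x₀ r, ∀ a : ℝ, 0 ≤ a → y + a • d ∈ ball x₀ r →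
      c * a ≤ φ (y + a • d) - φ y := by
    intro y hy a ha hya
    have hseg : ∀ s ∈ Icc 0 a, y + s • d ∈ ball x₀ r := by
      intro s hs
      rcases ha.eq_or_lt with rfl | ha'
      · have : s = 0 := le_antisymm hs.2 hs.1
        simpa [this] using hy
      · have := (convex_ball x₀ r).add_smul_sub_mem hy hya
          (t := s / a) ⟨div_nonneg hs.1 ha, (div_le_one ha').2 hs.2⟩
        have h2 : (s / a) • (y + a • d - y) = s • d := by
          rw [add_sub_cancel_left, smul_smul, div_mul_cancel₀ _ ha'.ne']
        rwa [h2] at this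
    have hder : ∀ s ∈ Icc 0 a, HasDerivAt (fun s : ℝ => φ (y + s • d))
        (fderiv ℝ φ (y + s • d) d) s := by
      intro s hs
      have h1 : HasDerivAt (fun s : ℝ => y + s • d) d s := by
        simpa using ((hasDerivAt_id s).smul_const d).const_add y
      exact (hφ _ (hseg s hs)).hasFDerivAt.comp_hasDerivAt s h1
    have := (convex_Icc (0 : ℝ) a).mul_sub_le_image_sub_of_le_deriv
      (f := fun s : ℝ => φ (y + s • d)) (C := c)
      (fun s hs => (hder s hs).continuousAt.continuousWithinAt)
      (fun s hs => (hder s (interior_subset hs)).differentiableAt.differentiableWithinAt)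
      (fun s hs => by
        rw [(hder s (interior_subset hs)).deriv]
        exact hφd _ (hseg s (interior_subset hs)))
      0 ⟨le_rfl, ha⟩ a ⟨ha, le_rfl⟩ ha
    simpa using this
  have hφc : ContinuousOn φ (ball x₀ r) := fun x hx => (hφ x hx).continuousAt.continuousWithinAt
  set R : ℝ := r + 2 / c * ‖d‖ with hR
  refine ⟨μ.real (ball x₀ R), measureReal_nonneg, fun ε hε => ?_⟩
  set L := ball x₀ r ∩ φ ⁻¹' Ioo (-ε) ε with hL
  have hLo : IsOpen L := hφc.isOpen_inter_preimage isOpen_ball isOpen_Ioo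
  obtain ⟨N, hN⟩ : ∃ N : ℕ, N = ⌈1 / ε⌉₊ := ⟨_, rfl⟩
  have hNle : 1 / ε ≤ N := hN ▸ Nat.le_ceil _
  have hNlt : ∀ i : ℕ, i < N → (i : ℝ) ≤ 1 / ε := by
    intro i hi
    rw [hN, Nat.lt_ceil] at hi
    exact hi.le
  have hNpos : (0 : ℝ) < N := lt_of_lt_of_le (by positivity) hNle
  -- Consecutive translates are `2ε / c` apart, so that `φ` increases by at least `2ε`, the height of
  -- the layer, from one to the next.
  let A : ℕ → Set V := fun i => (fun x => x + (-((i : ℝ) * (2 * ε / c))) • d) ⁻¹' L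
  have hAμ : ∀ i, μ (A i) = μ L := fun i => measure_preimage_add_right _ _ _
  have hAo : ∀ i, IsOpen (A i) := fun i => hLo.preimage (by fun_prop)
  have hlt : ∀ i j : ℕ, i < j → Disjoint (A i) (A j) := by
    intro i j hij
    rw [Set.disjoint_left]
    intro x hi hj
    have h1 : (1 : ℝ) ≤ (j : ℝ) - i := by
      have : (i : ℝ) + 1 ≤ j := by exact_mod_cast hij
      linarith
    have hs : 0 ≤ ((j : ℝ) - i) * (2 * ε / c) := by positivity
    have heq : (x + (-((j : ℝ) * (2 * ε / c))) • d) + (((j : ℝ) - i) * (2 * ε / c)) • d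
        = x + (-((i : ℝ) * (2 * ε / c))) • d := by
      module
    have h2 := hmono _ hj.1 _ hs (by rw [heq]; exact hi.1)
    rw [heq] at h2
    have h3 := hi.2.2
    have h4 := hj.2.1
    have h5 : c * (((j : ℝ) - i) * (2 * ε / c)) = ((j : ℝ) - i) * (2 * ε) := by
      field_simp
    nlinarith
  have hsub : (⋃ i ∈ Finset.range N, A i) ⊆ ball x₀ R := by
    intro x hx
    simp only [mem_iUnion, Finset.mem_range] at hx
    obtain ⟨i, hi, hx⟩ := hx
    have h1 : dist (x + (-((i : ℝ) * (2 * ε / c))) • d) x₀ < r := hx.1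
    have h2 : dist x (x + (-((i : ℝ) * (2 * ε / c))) • d) ≤ 2 / c * ‖d‖ := by
      rw [dist_self_add_right, norm_smul, norm_neg, Real.norm_of_nonneg (by positivity)]
      gcongr
      calc (i : ℝ) * (2 * ε / c) ≤ 1 / ε * (2 * ε / c) := by gcongr; exact hNlt i hi
        _ = 2 / c := by field_simp
    rw [mem_ball]
    linarith [dist_triangle x (x + (-((i : ℝ) * (2 * ε / c))) • d) x₀]
  have hsum : (N : ENNReal) * μ L ≤ μ (ball x₀ R) := by
    calc (N : ENNReal) * μ L = ∑ i ∈ Finset.range N, μ (A i) := by simp [hAμ]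
      _ = μ (⋃ i ∈ Finset.range N, A i) := by
        rw [measure_biUnion_finset (fun i _ j _ hij => ?_) fun i _ => (hAo i).measurableSet]
        rcases lt_or_gt_of_ne hij with h | h
        · exact hlt i j h
        · exact (hlt j i h).symm
      _ ≤ μ (ball x₀ R) := measure_mono hsub
  have hLfin : μ L ≠ ⊤ :=
    ne_top_of_le_ne_top measure_ball_lt_top.ne (measure_mono inter_subset_left)
  have hreal : (N : ℝ) * μ.real L ≤ μ.real (ball x₀ R) := by
    have := ENNReal.toReal_mono measure_ball_lt_top.ne hsum
    simpa [Measure.real] using this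
  rw [ENNReal.le_ofReal_iff_toReal_le hLfin (by positivity)]
  have h6 : 1 ≤ (N : ℝ) * ε := by
    rw [div_le_iff₀ hε] at hNle
    exact hNle
  have h7 : 0 ≤ μ.real L := measureReal_nonneg
  change μ.real L ≤ _
  nlinarith

theorem integrableOn_of_continuousOn_of_bounded {G : Type*} [NormedAddCommGroup G]
    {Ω : Set E3} (hΩ : IsOpen Ω) (hfin : volume Ω ≠ ⊤) {g : E3 → G} {M : ℝ}
    (hg : ContinuousOn g Ω) (hM : ∀ x ∈ Ω, ‖g x‖ ≤ M) : IntegrableOn g Ω :=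
  IntegrableOn.of_bound hfin.lt_top (hg.aestronglyMeasurable hΩ.measurableSet) M
    ((ae_restrict_iff' hΩ.measurableSet).2 (Eventually.of_forall hM))

/-- If `w` is tangent to the level set `φ = 0` at the boundary points of `Ω = {φ < 0}`, then
its derivative along `φ` is small near the boundary. -/
theorem exists_abs_fderiv_apply_le_near_frontier {Ω K : Set E3} {w : E3 → E3} {φ : E3 → ℝ}
    {x₀ : E3} {r δ : ℝ} (hwc : ContinuousOn w (closure Ω)) (hK : IsCompact K)
    (hKB : K ⊆ ball x₀ r) (hφ : ContDiffOn ℝ 1 φ (ball x₀ r))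
    (hmem : ∀ x ∈ ball x₀ r, (x ∈ Ω ↔ φ x < 0))
    (hn : ∀ x ∈ frontier Ω ∩ ball x₀ r, fderiv ℝ φ x (w x) = 0) (hδ : 0 < δ) :
    ∃ ε₀ : ℝ, 0 < ε₀ ∧ ∀ x ∈ Ω ∩ K, -ε₀ < φ x → |fderiv ℝ φ x (w x)| ≤ δ := by
  have hcpt : IsCompact (closure Ω ∩ K) := hK.inter_left isClosed_closure
  have hcont : ContinuousOn (fun x => |fderiv ℝ φ x (w x)|) (closure Ω ∩ K) :=
    (((hφ.continuousOn_fderiv_of_isOpen isOpen_ball le_rfl).mono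
      (inter_subset_right.trans hKB)).clm_apply (hwc.mono inter_subset_left)).abs
  have hS : IsCompact ((closure Ω ∩ K) ∩ (fun x => |fderiv ℝ φ x (w x)|) ⁻¹' Ici δ) :=
    hcpt.of_isClosed_subset (hcont.preimage_isClosed_of_isClosed hcpt.isClosed isClosed_Ici)
      inter_subset_left
  rcases Set.eq_empty_or_nonempty
    ((closure Ω ∩ K) ∩ (fun x => |fderiv ℝ φ x (w x)|) ⁻¹' Ici δ) with hem | hne
  · refine ⟨1, one_pos, fun x hx _ => le_of_lt (not_le.1 fun hle => ?_)⟩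
    have : x ∈ (closure Ω ∩ K) ∩ (fun x => |fderiv ℝ φ x (w x)|) ⁻¹' Ici δ :=
      ⟨⟨subset_closure hx.1, hx.2⟩, hle⟩
    rw [hem] at this
    exact this
  · obtain ⟨z, hz, hmax⟩ := hS.exists_isMaxOn hne
      (hφ.continuousOn.mono ((inter_subset_left.trans inter_subset_right).trans hKB))
    have hzB : z ∈ ball x₀ r := hKB hz.1.2
    have hz0 : φ z < 0 := by
      rw [← hmem z hzB]
      by_contra hzΩ
      have h0 := hn z ⟨⟨hz.1.1, fun h => hzΩ (interior_subset h)⟩, hzB⟩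
      have h1 : δ ≤ |fderiv ℝ φ z (w z)| := hz.2
      rw [h0, abs_zero] at h1
      exact absurd hδ (not_lt.2 h1)
    refine ⟨-φ z, by linarith, fun x hx hxφ => le_of_lt (not_le.1 fun hle => ?_)⟩
    have := hmax (show x ∈ (closure Ω ∩ K) ∩ (fun x => |fderiv ℝ φ x (w x)|) ⁻¹' Ici δ from
      ⟨⟨subset_closure hx.1, hx.2⟩, hle⟩)
    simp only [mem_ofPred_eq] at this
    linarith

/-- The divergence theorem for a field that is tangent to the boundary and supported in a small
ball, in which the boundary is a level set of `φ`. The field is multiplied by a cut-off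
function of `φ / ε`. The gradient of the cut-off is of size `1 / ε` and lives in a
layer of volume `O(ε)`, but there it is paired with a field whose component along `∇φ` is small. -/
theorem setIntegral_divergence_eq_zero_of_support_subset_ball {Ω K : Set E3} {w : E3 → E3}
    {φ : E3 → ℝ} {x₀ d : E3} {r c M : ℝ} (hΩ : IsOpen Ω) (hfin : volume Ω ≠ ⊤)
    (hw : ContDiffOn ℝ 1 w Ω) (hwc : ContinuousOn w (closure Ω))
    (hdiv : ∀ x ∈ Ω, ‖divergence w x‖ ≤ M) (hM : 0 ≤ M)
    (hK : IsCompact K) (hKB : K ⊆ ball x₀ r) (hwK : ∀ x ∉ K, w x = 0)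
    (hφ : ContDiffOn ℝ 1 φ (ball x₀ r)) (hc : 0 < c)
    (hφd : ∀ x ∈ ball x₀ r, c ≤ fderiv ℝ φ x d)
    (hmem : ∀ x ∈ ball x₀ r, (x ∈ Ω ↔ φ x < 0))
    (hn : ∀ x ∈ frontier Ω ∩ ball x₀ r, fderiv ℝ φ x (w x) = 0) :
    ∫ x in Ω, divergence w x = 0 := by
  have hφat : ∀ x ∈ ball x₀ r, ContDiffAt ℝ 1 φ x := fun x hx =>
    hφ.contDiffAt (isOpen_ball.mem_nhds hx)
  have hwat : ∀ x ∈ Ω, ContDiffAt ℝ 1 w x := fun x hx => hw.contDiffAt (hΩ.mem_nhds hx)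
  obtain ⟨A, hA, hlayer⟩ := exists_measure_layer_le (volume : Measure E3) hc
    (fun x hx => (hφat x hx).differentiableAt one_ne_zero) hφd
  -- The cut-off: `η = 1` on `(-∞, -2]` and `η = 0` on `[-1, ∞)`.
  obtain ⟨η, hη⟩ : ∃ η : ℝ → ℝ, η = fun s => Real.smoothTransition (-s - 1) := ⟨_, rfl⟩
  have hηd : ContDiff ℝ 1 η := by
    rw [hη]
    exact Real.smoothTransition.contDiff.comp (by fun_prop)
  have hη0 : ∀ s, -1 ≤ s → η s = 0 := fun s hs => by
    rw [hη]; exact Real.smoothTransition.zero_of_nonpos (by linarith)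
  have hη1 : ∀ s, s ≤ -2 → η s = 1 := fun s hs => by
    rw [hη]; exact Real.smoothTransition.one_of_one_le (by linarith)
  have hηle : ∀ s, ‖η s - 1‖ ≤ 1 := fun s => by
    rw [hη, Real.norm_eq_abs, abs_le]
    constructor <;> linarith [Real.smoothTransition.nonneg (-s - 1),
      Real.smoothTransition.le_one (-s - 1)]
  obtain ⟨D, hD⟩ := (isCompact_Icc (a := (-2 : ℝ)) (b := 0)).exists_bound_of_continuousOn
    (hηd.continuous_deriv le_rfl).continuousOn
  have hD0 : 0 ≤ D := (norm_nonneg _).trans (hD 0 (by norm_num))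
  have hint : IntegrableOn (divergence w) Ω :=
    integrableOn_of_continuousOn_of_bounded hΩ hfin (continuousOn_divergence hΩ hw) hdiv
  -- `δ` bounds both `ε` and the component of `w` along `∇φ` in the layer.
  have hmain : ∀ δ : ℝ, 0 < δ → ‖∫ x in Ω, divergence w x‖ ≤ 3 * A * (M + D) * δ := by
    intro δ hδ
    obtain ⟨ε₀, hε₀, hsmall⟩ := exists_abs_fderiv_apply_le_near_frontier hwc hK hKB hφ hmem hn hδ
    obtain ⟨ε, hε, hεδ, hεε₀⟩ : ∃ ε : ℝ, 0 < ε ∧ ε ≤ δ ∧ 2 * ε < ε₀ :=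
      ⟨min δ (ε₀ / 3), by positivity, min_le_left _ _, by
        have := min_le_right δ (ε₀ / 3)
        linarith⟩
    -- Since `w` vanishes outside `K` and `η (φ / ε)` near the boundary, `W` is `C¹` everywhere.
    let W : E3 → E3 := Ω.indicator fun x => η (φ x / ε) • w x
    have hWK : ∀ x ∉ K, W =ᶠ[𝓝 x] fun _ => 0 := fun x hx =>
      Filter.mem_of_superset (hK.isClosed.isOpen_compl.mem_nhds hx) fun y hy => by
        simp [W, hwK y hy, Set.indicator]
    have hwK' : ∀ x ∉ K, w =ᶠ[𝓝 x] fun _ => 0 := fun x hx =>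
      Filter.mem_of_superset (hK.isClosed.isOpen_compl.mem_nhds hx) fun y hy => hwK y hy
    have hWout : ∀ x ∉ Ω, W =ᶠ[𝓝 x] fun _ => 0 := by
      intro x hx
      by_cases hxK : x ∈ K
      · have hxB := hKB hxK
        have h0 : -ε < φ x := by
          have : ¬ φ x < 0 := fun h => hx ((hmem x hxB).2 h)
          linarith
        filter_upwards [(hφat x hxB).continuousAt.eventually (lt_mem_nhds h0)] with y hy
        have : -1 ≤ φ y / ε := by
          rw [le_div_iff₀ hε]
          linarith
        simp [W, hη0 _ this, Set.indicator]
      · exact hWK x hxK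
    have hWin : ∀ x ∈ Ω, W =ᶠ[𝓝 x] fun y => η (φ y / ε) • w y := fun x hx =>
      Filter.mem_of_superset (hΩ.mem_nhds hx) fun y hy => Set.indicator_of_mem hy _
    have hηφ : ∀ x ∈ ball x₀ r, ContDiffAt ℝ 1 (fun y => η (φ y / ε)) x := fun x hx =>
      hηd.contDiffAt.comp x ((hφat x hx).div_const ε)
    have hWd : ContDiff ℝ 1 W := by
      rw [contDiff_iff_contDiffAt]
      intro x
      by_cases hx : x ∈ Ω
      · by_cases hxK : x ∈ K
        · exact ((hηφ x (hKB hxK)).smul (hwat x hx)).congr_of_eventuallyEq (hWin x hx)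
        · exact contDiffAt_const.congr_of_eventuallyEq (hWK x hxK)
      · exact contDiffAt_const.congr_of_eventuallyEq (hWout x hx)
    have hWc : HasCompactSupport W :=
      HasCompactSupport.intro hK fun x hx => (hWK x hx).eq_of_nhds
    have hdiv0 : divergence (fun _ => (0 : E3)) = fun _ => 0 := by
      funext x
      simp [divergence, pderiv]
    have hWint : IntegrableOn (divergence W) Ω := by
      have h1 : Continuous (divergence W) :=
        continuousOn_univ.1 (continuousOn_divergence isOpen_univ hWd.contDiffOn)
      refine (h1.integrable_of_hasCompactSupport
        (HasCompactSupport.intro hK fun x hx => ?_)).integrableOn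
      rw [divergence_congr (hWK x hx), hdiv0]
    have hW0 : ∫ x in Ω, divergence W x = 0 := by
      rw [setIntegral_eq_integral_of_forall_compl_eq_zero fun x hx => by
        rw [divergence_congr (hWout x hx), hdiv0]]
      exact integral_divergence_eq_zero_of_hasCompactSupport hWd hWc
    -- `div W` and `div w` differ only where `-2ε ≤ φ < 0`.
    let L := ball x₀ r ∩ φ ⁻¹' Ioo (-(3 * ε)) (3 * ε)
    have hLo : IsOpen L := hφ.continuousOn.isOpen_inter_preimage isOpen_ball isOpen_Ioo
    have hLμ : volume.real L ≤ A * (3 * ε) := by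
      have h := hlayer (3 * ε) (by positivity)
      exact ENNReal.toReal_le_of_le_ofReal (by positivity) h
    have hLfin : volume L ≠ ⊤ := ne_top_of_le_ne_top ENNReal.ofReal_ne_top
      (hlayer (3 * ε) (by positivity))
    have hbound : ∀ x ∈ Ω, ‖divergence W x - divergence w x‖
        ≤ L.indicator (fun _ => M + D * δ / ε) x := by
      intro x hx
      by_cases hxK : x ∈ K
      · have hxB := hKB hxK
        have hx0 := (hmem x hxB).1 hx
        rcases lt_or_ge (φ x) (-2 * ε) with h | h
        · have hev : W =ᶠ[𝓝 x] w := by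
            filter_upwards [(hφat x hxB).continuousAt.eventually (gt_mem_nhds h), hWin x hx]
              with y hy hyW
            have : φ y / ε ≤ -2 := by
              rw [div_le_iff₀ hε]
              linarith
            rw [hyW, hη1 _ this, one_smul]
          rw [divergence_congr hev, sub_self, norm_zero]
          exact Set.indicator_nonneg (fun _ _ => by positivity) _
        · have hxL : x ∈ L := ⟨hxB, by constructor <;> linarith⟩
          rw [Set.indicator_of_mem hxL, divergence_congr (hWin x hx),
            divergence_smul ((hηφ x hxB).differentiableAt one_ne_zero)
              ((hwat x hx).differentiableAt one_ne_zero)]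
          have hfd : fderiv ℝ (fun y => η (φ y / ε)) x (w x)
              = deriv η (φ x / ε) * (fderiv ℝ φ x (w x) / ε) := by
            have h1 : HasFDerivAt (fun y => φ y / ε) (ε⁻¹ • fderiv ℝ φ x) x := by
              simpa [div_eq_inv_mul] using
                ((hφat x hxB).differentiableAt one_ne_zero).hasFDerivAt.const_mul ε⁻¹
            have h2 := ((hηd.differentiable one_ne_zero) (φ x / ε)).hasDerivAt.comp_hasFDerivAt x h1
            rw [show (fun y => η (φ y / ε)) = η ∘ fun y => φ y / ε from rfl, h2.fderiv]
            simp [div_eq_inv_mul]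
          rw [hfd]
          have hs : φ x / ε ∈ Icc (-2 : ℝ) 0 :=
            ⟨by rw [le_div_iff₀ hε]; linarith, div_nonpos_of_nonpos_of_nonneg hx0.le hε.le⟩
          have e1 : ‖(η (φ x / ε) - 1) * divergence w x‖ ≤ 1 * M := by
            rw [norm_mul]
            exact mul_le_mul (hηle _) (hdiv x hx) (norm_nonneg _) zero_le_one
          have e2 : ‖deriv η (φ x / ε) * (fderiv ℝ φ x (w x) / ε)‖ ≤ D * (δ / ε) := by
            rw [norm_mul, norm_div, Real.norm_of_nonneg hε.le]
            refine mul_le_mul (hD _ hs) ?_ (by positivity) hD0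
            exact div_le_div_of_nonneg_right (hsmall x ⟨hx, hxK⟩ (by linarith)) hε.le
          calc ‖η (φ x / ε) * divergence w x + deriv η (φ x / ε) * (fderiv ℝ φ x (w x) / ε)
                - divergence w x‖
              = ‖(η (φ x / ε) - 1) * divergence w x
                + deriv η (φ x / ε) * (fderiv ℝ φ x (w x) / ε)‖ := by ring_nf
            _ ≤ 1 * M + D * (δ / ε) := (norm_add_le _ _).trans (add_le_add e1 e2)
            _ = M + D * δ / ε := by ring
      · rw [divergence_congr (hWK x hxK), divergence_congr (hwK' x hxK), sub_self, norm_zero]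
        exact Set.indicator_nonneg (fun _ _ => by positivity) _
    have hLint : Integrable (L.indicator fun _ => M + D * δ / ε) (volume : Measure E3) :=
      (integrable_indicator_iff hLo.measurableSet).2 (integrableOn_const hLfin)
    have h1 : ∫ x in Ω, (divergence W x - divergence w x) = -∫ x in Ω, divergence w x := by
      rw [integral_sub hWint hint, hW0, zero_sub]
    calc ‖∫ x in Ω, divergence w x‖ = ‖∫ x in Ω, (divergence W x - divergence w x)‖ := by
          rw [h1, norm_neg]
      _ ≤ ∫ x in Ω, L.indicator (fun _ => M + D * δ / ε) x :=
          norm_integral_le_of_norm_le hLint.integrableOn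
            ((ae_restrict_iff' hΩ.measurableSet).2 (Eventually.of_forall hbound))
      _ ≤ ∫ x, L.indicator (fun _ => M + D * δ / ε) x :=
          setIntegral_le_integral hLint
            (Eventually.of_forall fun x => Set.indicator_nonneg (fun _ _ => by positivity) x)
      _ = volume.real L * (M + D * δ / ε) := by
          rw [integral_indicator hLo.measurableSet, setIntegral_const, smul_eq_mul]
      _ ≤ A * (3 * ε) * (M + D * δ / ε) := by gcongr
      _ = 3 * A * (M * ε + D * δ) := by field_simp
      _ ≤ 3 * A * (M * δ + D * δ) := by gcongr
      _ = 3 * A * (M + D) * δ := by ring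
  rw [← norm_le_zero_iff]
  refine le_of_forall_pos_le_add fun δ hδ => ?_
  have hB : 0 ≤ 3 * A * (M + D) := by positivity
  refine (hmain (δ / (3 * A * (M + D) + 1)) (by positivity)).trans ?_
  rw [zero_add, mul_div_assoc', div_le_iff₀ (by positivity)]
  nlinarith

/-- Near a boundary point of a `C²`-domain, the boundary is a regular level set, and a field that
annihilates the normals is tangent to it. -/
theorem exists_ball_of_mem_frontier {Ω : Set E3} (h : IsBoundedDomainOfClassTwo Ω)
    {u : E3 → E3} (hn : ∀ x n, IsUnitOuterNormal Ω x n → inner ℝ n (u x) = 0)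
    {x₀ : E3} (hx₀ : x₀ ∈ frontier Ω) :
    ∃ (φ : E3 → ℝ) (d : E3) (r c : ℝ), 0 < r ∧ 0 < c ∧ ContDiffOn ℝ 1 φ (ball x₀ r) ∧
      (∀ x ∈ ball x₀ r, c ≤ fderiv ℝ φ x d) ∧ (∀ x ∈ ball x₀ r, (x ∈ Ω ↔ φ x < 0)) ∧
      ∀ x ∈ frontier Ω ∩ ball x₀ r, fderiv ℝ φ x (u x) = 0 := by
  obtain ⟨φ, hφ⟩ := h.exists_definingFunction x₀ hx₀
  have hgrad : ∀ x a : E3, fderiv ℝ φ x a = inner ℝ (gradient φ x) a := fun x a => by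
    rw [gradient, InnerProductSpace.toDual_symm_apply]
  have hpos : 0 < fderiv ℝ φ x₀ (gradient φ x₀) := by
    rw [hgrad, real_inner_self_eq_norm_sq]
    have := norm_pos_iff.2 hφ.gradient_ne_zero
    positivity
  have hcont : ContinuousAt (fun x => fderiv ℝ φ x (gradient φ x₀)) x₀ :=
    (hφ.contDiffAt.continuousAt_fderiv two_ne_zero).clm_apply continuousAt_const
  have hev := (hcont.eventually (lt_mem_nhds (half_lt_self hpos))).and
    ((hφ.contDiffAt.eventually (by simp)).and hφ.mem_iff.eventually_nhds)
  obtain ⟨r, hr, hball⟩ := Metric.eventually_nhds_iff_ball.1 hev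
  refine ⟨φ, gradient φ x₀, r, _, hr, half_pos hpos, fun x hx => ?_, fun x hx => (hball x hx).1.le,
    fun x hx => (hball x hx).2.2.self_of_nhds, fun x hx => ?_⟩
  · exact ((hball x hx).2.1.of_le one_le_two).contDiffWithinAt
  · have hb := hball x hx.2
    have hne : gradient φ x ≠ 0 := by
      intro h0
      have h1 := hb.1
      rw [hgrad, h0, inner_zero_left] at h1
      linarith
    have h2 := hn x _ ⟨hx.1, φ, ⟨hb.2.1, hne, hb.2.2⟩, rfl⟩
    rw [real_inner_smul_left, mul_eq_zero, inv_eq_zero, norm_eq_zero] at h2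
    rw [hgrad]
    exact h2.resolve_left hne

/-- The divergence theorem on a bounded `C²`-domain, for a field that is tangent to the boundary.
The field need only be `C¹` inside, continuous up to the boundary, and have a bounded divergence. -/
theorem setIntegral_divergence_eq_zero {Ω : Set E3} (h : IsBoundedDomainOfClassTwo Ω)
    {u : E3 → E3} {M : ℝ} (hu : ContDiffOn ℝ 1 u Ω) (huc : ContinuousOn u (closure Ω))
    (hdiv : ∀ x ∈ Ω, ‖divergence u x‖ ≤ M)
    (hn : ∀ x n, IsUnitOuterNormal Ω x n → inner ℝ n (u x) = 0) :
    ∫ x in Ω, divergence u x = 0 := by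
  have hfin : volume Ω ≠ ⊤ := h.isBounded.measure_lt_top.ne
  have hcpt : IsCompact (closure Ω) := h.isBounded.isCompact_closure
  have huat : ∀ x ∈ Ω, ContDiffAt ℝ 1 u x := fun x hx => hu.contDiffAt (h.isOpen.mem_nhds hx)
  obtain ⟨M', hM'⟩ := hcpt.exists_bound_of_continuousOn huc
  have hdivψ : ∀ ψ : E3 → ℝ, ContDiff ℝ 1 ψ → ∀ x ∈ Ω,
      divergence (fun y => ψ y • u y) x = ψ x * divergence u x + fderiv ℝ ψ x (u x) :=
    fun ψ hψ x hx => divergence_smul (hψ.differentiable one_ne_zero x)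
      ((huat x hx).differentiableAt one_ne_zero)
  have hbψ : ∀ ψ : E3 → ℝ, ContDiff ℝ 1 ψ →
      ∃ B, 0 ≤ B ∧ ∀ x ∈ Ω, ‖divergence (fun y => ψ y • u y) x‖ ≤ B := by
    intro ψ hψ
    obtain ⟨B₁, hB₁⟩ := hcpt.exists_bound_of_continuousOn hψ.continuous.continuousOn
    obtain ⟨B₂, hB₂⟩ := hcpt.exists_bound_of_continuousOn
      (hψ.continuous_fderiv one_ne_zero).continuousOn
    obtain ⟨z, hz⟩ := h.isConnected.nonempty
    have hb : ∀ x ∈ Ω, ‖divergence (fun y => ψ y • u y) x‖ ≤ B₁ * M + B₂ * M' := by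
      intro x hx
      have hx' := subset_closure hx
      rw [hdivψ ψ hψ x hx]
      refine (norm_add_le _ _).trans (add_le_add ?_ ?_)
      · rw [norm_mul]
        exact mul_le_mul (hB₁ x hx') (hdiv x hx) (norm_nonneg _)
          ((norm_nonneg _).trans (hB₁ x hx'))
      · exact (ContinuousLinearMap.le_opNorm _ _).trans (mul_le_mul (hB₂ x hx') (hM' x hx')
          (norm_nonneg _) ((norm_nonneg _).trans (hB₂ x hx')))
    exact ⟨_, (norm_nonneg _).trans (hb z hz), hb⟩
  have hloc : ∀ x₀ ∈ closure Ω, ∃ r : ℝ, 0 < r ∧ ∀ ψ : E3 → ℝ, ContDiff ℝ 1 ψ →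
      tsupport ψ ⊆ ball x₀ r → ∫ x in Ω, divergence (fun y => ψ y • u y) x = 0 := by
    intro x₀ hx₀
    by_cases hxΩ : x₀ ∈ Ω
    · obtain ⟨r, hr, hrΩ⟩ := Metric.isOpen_iff.1 h.isOpen x₀ hxΩ
      refine ⟨r, hr, fun ψ hψ hsupp => ?_⟩
      have hzero : ∀ x ∉ tsupport ψ, (fun y => ψ y • u y) =ᶠ[𝓝 x] fun _ => 0 := fun x hx =>
        Filter.mem_of_superset ((isClosed_tsupport ψ).isOpen_compl.mem_nhds hx) fun y hy => by
          simp [image_eq_zero_of_notMem_tsupport hy]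
      have hC1 : ContDiff ℝ 1 fun y => ψ y • u y := by
        rw [contDiff_iff_contDiffAt]
        intro x
        by_cases hx : x ∈ tsupport ψ
        · exact hψ.contDiffAt.smul (huat x (hrΩ (hsupp hx)))
        · exact contDiffAt_const.congr_of_eventuallyEq (hzero x hx)
      have hψc : HasCompactSupport ψ :=
        Metric.isCompact_of_isClosed_isBounded (isClosed_tsupport ψ) (isBounded_ball.subset hsupp)
      rw [setIntegral_eq_integral_of_forall_compl_eq_zero fun x hx => ?_]
      · exact integral_divergence_eq_zero_of_hasCompactSupport hC1
          (HasCompactSupport.intro hψc fun x hx => (hzero x hx).eq_of_nhds)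
      · rw [divergence_congr (hzero x fun h' => hx (hrΩ (hsupp h')))]
        simp [divergence, pderiv]
    · have hfr : x₀ ∈ frontier Ω := ⟨hx₀, fun h' => hxΩ (interior_subset h')⟩
      obtain ⟨φ, d, r, c, hr, hc, hφ, hφd, hmem, hφn⟩ := exists_ball_of_mem_frontier h hn hfr
      refine ⟨r, hr, fun ψ hψ hsupp => ?_⟩
      obtain ⟨B, hB0, hB⟩ := hbψ ψ hψ
      refine setIntegral_divergence_eq_zero_of_support_subset_ball h.isOpen hfin
        (hψ.contDiffOn.smul hu) (hψ.continuous.continuousOn.smul huc) hB hB0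
        (Metric.isCompact_of_isClosed_isBounded (isClosed_tsupport ψ) (isBounded_ball.subset hsupp))
        hsupp (fun x hx => by simp [image_eq_zero_of_notMem_tsupport hx]) hφ hc hφd hmem
        fun x hx => ?_
      rw [map_smul, hφn x hx, smul_zero]
  choose! r hr hψ0 using hloc
  obtain ⟨t, htsub, htcover⟩ := hcpt.elim_nhds_subcover (fun x => ball x (r x))
    fun x hx => ball_mem_nhds x (hr x hx)
  obtain ⟨ψ, hψ⟩ := SmoothPartitionOfUnity.exists_isSubordinate 𝓘(ℝ, E3) isClosed_closure
    (fun i : t => ball (i : E3) (r i)) (fun i => isOpen_ball) (fun x hx => by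
      obtain ⟨i, hi, hxi⟩ := mem_iUnion₂.1 (htcover hx)
      exact mem_iUnion.2 ⟨⟨i, hi⟩, hxi⟩)
  have hψd : ∀ i : t, ContDiff ℝ 1 (ψ i) := fun i =>
    ((ψ i).contMDiff.contDiff).of_le (by exact_mod_cast le_top)
  have hsum : ∀ x ∈ closure Ω, ∑ i : t, ψ i x = 1 := fun x hx => by
    rw [← finsum_eq_sum_of_fintype]
    exact ψ.sum_eq_one hx
  have hdecomp : ∀ x ∈ Ω, divergence u x = ∑ i : t, divergence (fun y => ψ i y • u y) x := by
    intro x hx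
    have hconst : (fun y => ∑ i : t, ψ i y) =ᶠ[𝓝 x] fun _ => 1 :=
      Filter.mem_of_superset (h.isOpen.mem_nhds hx) fun y hy => hsum y (subset_closure hy)
    have hder : ∑ i : t, fderiv ℝ (ψ i) x = 0 := by
      rw [← fderiv_fun_sum fun i _ => (hψd i).differentiable one_ne_zero x, hconst.fderiv_eq]
      simp
    have happ := congrArg (fun L : E3 →L[ℝ] ℝ => L (u x)) hder
    simp only [sum_apply, zero_apply] at happ
    rw [Finset.sum_congr rfl fun i _ => hdivψ (ψ i) (hψd i) x hx, Finset.sum_add_distrib, happ,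
      ← Finset.sum_mul, hsum x (subset_closure hx), one_mul, add_zero]
  rw [setIntegral_congr_fun h.isOpen.measurableSet hdecomp, integral_finsetSum]
  · exact Finset.sum_eq_zero fun i _ => hψ0 i (htsub i i.2) _ (hψd i) (hψ i)
  · intro i _
    obtain ⟨B, -, hB⟩ := hbψ (ψ i) (hψd i)
    exact integrableOn_of_continuousOn_of_bounded h.isOpen hfin
      (continuousOn_divergence h.isOpen ((hψd i).contDiffOn.smul hu)) hB

/-! ### Partial derivatives of functions of time and position -/

section Partial

variable {G : Type*} [NormedAddCommGroup G] [NormedSpace ℝ G] {g : ℝ → E3 → G} {t : ℝ} {x : E3}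

theorem hasFDerivAt_space (hg : DifferentiableAt ℝ (Function.uncurry g) (t, x)) :
    HasFDerivAt (g t)
      ((fderiv ℝ (Function.uncurry g) (t, x)).comp (ContinuousLinearMap.inr ℝ ℝ E3)) x :=
  HasFDerivAt.comp x (g := Function.uncurry g) (f := fun y => (t, y)) hg.hasFDerivAt
    (hasFDerivAt_prodMk_right t x)

theorem hasDerivAt_time (hg : DifferentiableAt ℝ (Function.uncurry g) (t, x)) :
    HasDerivAt (fun s => g s x) (fderiv ℝ (Function.uncurry g) (t, x) (1, 0)) t := by
  have h : HasDerivAt (fun s : ℝ => (s, x)) ((1 : ℝ), (0 : E3)) t :=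
    (hasDerivAt_id t).prodMk (hasDerivAt_const t x)
  exact HasFDerivAt.comp_hasDerivAt t (l := Function.uncurry g) (f := fun s => (s, x))
    hg.hasFDerivAt h

theorem materialDeriv_eq (v : ℝ → E3 → E3)
    (hg : DifferentiableAt ℝ (Function.uncurry g) (t, x)) :
    materialDeriv v g t x = fderiv ℝ (Function.uncurry g) (t, x) (1, v t x) := by
  rw [materialDeriv, (hasDerivAt_time hg).deriv, (hasFDerivAt_space hg).fderiv]
  simp only [ContinuousLinearMap.comp_apply, ContinuousLinearMap.inr_apply]
  rw [← map_add]
  simp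

theorem eventually_differentiableAt_uncurry {n : WithTop ℕ∞} (hn : n ≠ 0) (hn' : n ≠ ∞)
    {p : ℝ × E3} (hg : ContDiffAt ℝ n (Function.uncurry g) p) :
    ∀ᶠ q in 𝓝 p, DifferentiableAt ℝ (Function.uncurry g) q :=
  (hg.eventually hn').mono fun _ hq => hq.differentiableAt hn

end Partial

/-! ### The flow map and its Jacobian determinant -/

theorem det_eq_det_coord (L : E3 →L[ℝ] E3) :
    L.det = (Matrix.of fun i j : Fin 3 => L (EuclideanSpace.single j 1) i).det := by
  rw [ContinuousLinearMap.det,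
    ← LinearMap.det_toMatrix (EuclideanSpace.basisFun (Fin 3) ℝ).toBasis]
  congr 1

/-- Jacobi's formula for a curve of `3 × 3` matrices solving `L' = A L`. -/
theorem hasDerivAt_det_of_hasDerivAt_comp {L : ℝ → E3 →L[ℝ] E3} {A : E3 →L[ℝ] E3} {t : ℝ}
    (hL : ∀ a, HasDerivAt (fun s => L s a) (A (L t a)) t) :
    HasDerivAt (fun s => (L s).det)
      ((∑ i, A (EuclideanSpace.single i 1) i) * (L t).det) t := by
  have hent : ∀ i j : Fin 3, HasDerivAt (fun s => L s (EuclideanSpace.single j 1) i)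
      (∑ k, L t (EuclideanSpace.single j 1) k * A (EuclideanSpace.single k 1) i) t := by
    intro i j
    have h1 := (PiLp.proj (𝕜 := ℝ) 2 (fun _ : Fin 3 => ℝ) i).hasFDerivAt.comp_hasDerivAt t
      (hL (EuclideanSpace.single j 1))
    have h2 : A (L t (EuclideanSpace.single j 1)) i
        = ∑ k, L t (EuclideanSpace.single j 1) k * A (EuclideanSpace.single k 1) i :=
      (sum_coord_mul_apply ((PiLp.proj (𝕜 := ℝ) 2 (fun _ : Fin 3 => ℝ) i).comp A) _).symm
    rw [← h2]
    exact h1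
  simp only [det_eq_det_coord, Matrix.det_fin_three, Matrix.of_apply]
  have key := (((((((hent 0 0).mul (hent 1 1)).mul (hent 2 2)).sub
    (((hent 0 0).mul (hent 1 2)).mul (hent 2 1))).sub
    (((hent 0 1).mul (hent 1 0)).mul (hent 2 2))).add
    (((hent 0 1).mul (hent 1 2)).mul (hent 2 0))).add
    (((hent 0 2).mul (hent 1 0)).mul (hent 2 1))).sub
    (((hent 0 2).mul (hent 1 1)).mul (hent 2 0))
  refine key.congr_deriv ?_
  simp only [Fin.sum_univ_three, Pi.mul_apply]
  ring

/-- The absolute value of a solution of `J' = a J` solves the same equation, also at the zeros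
of `J`, where the derivative of `J` vanishes. -/
theorem hasDerivAt_abs_of_hasDerivAt_mul {J : ℝ → ℝ} {a t : ℝ}
    (hJ : HasDerivAt J (a * J t) t) : HasDerivAt (fun s => |J s|) (a * |J t|) t := by
  rcases lt_trichotomy (J t) 0 with h | h | h
  · rw [abs_of_neg h, mul_neg]
    refine hJ.neg.congr_of_eventuallyEq ?_
    filter_upwards [hJ.continuousAt.eventually (gt_mem_nhds h)] with s hs
    simpa using abs_of_neg hs
  · rw [h, mul_zero] at hJ
    rw [h, abs_zero, mul_zero]
    rw [hasDerivAt_iff_isLittleO] at hJ ⊢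
    simp only [h, abs_zero, smul_zero, sub_zero] at hJ ⊢
    exact hJ.norm_left
  · rw [abs_of_pos h]
    refine hJ.congr_of_eventuallyEq ?_
    filter_upwards [hJ.continuousAt.eventually (lt_mem_nhds h)] with s hs
    exact abs_of_pos hs

/-- The deformation gradient `DX` of the flow solves `∂ₜ DX = (Dv ∘ X) DX`: the derivatives in time
and position commute. -/
theorem hasDerivAt_fderiv_flow {X v : ℝ → E3 → E3} {t : ℝ} {ξ : E3} {U : Set E3}
    (hU : IsOpen U) (hξ : ξ ∈ U) (hX : ContDiffAt ℝ 2 (Function.uncurry X) (t, ξ))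
    (hXv : ∀ η ∈ U, HasDerivAt (fun s => X s η) (v t (X t η)) t)
    (hv : DifferentiableAt ℝ (v t) (X t ξ)) (a : E3) :
    HasDerivAt (fun s => fderiv ℝ (X s) ξ a)
      (fderiv ℝ (v t) (X t ξ) (fderiv ℝ (X t) ξ a)) t := by
  have hdiff := eventually_differentiableAt_uncurry two_ne_zero (by simp) hX
  have hD : DifferentiableAt ℝ (fderiv ℝ (Function.uncurry X)) (t, ξ) :=
    (hX.fderiv_right (m := 1) (by norm_num)).differentiableAt one_ne_zero
  have hline : ContinuousAt (fun s : ℝ => (s, ξ)) t := by fun_prop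
  have hslice : ContinuousAt (fun η : E3 => (t, η)) ξ := by fun_prop
  -- The derivative in time of `DX a`.
  have h1 : HasDerivAt (fun s => fderiv ℝ (X s) ξ a)
      (fderiv ℝ (fderiv ℝ (Function.uncurry X)) (t, ξ) (1, 0) (0, a)) t := by
    have h2 : HasDerivAt (fun s : ℝ => fderiv ℝ (Function.uncurry X) (s, ξ) (0, a))
        (fderiv ℝ (fderiv ℝ (Function.uncurry X)) (t, ξ) (1, 0) (0, a)) t := by
      have h3 : HasDerivAt (fun s : ℝ => (s, ξ)) ((1 : ℝ), (0 : E3)) t :=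
        (hasDerivAt_id t).prodMk (hasDerivAt_const t ξ)
      have h4 := HasFDerivAt.comp_hasDerivAt t (l := fderiv ℝ (Function.uncurry X))
        (f := fun s => (s, ξ)) hD.hasFDerivAt h3
      simpa using h4.clm_apply (hasDerivAt_const t ((0 : ℝ), a))
    refine h2.congr_of_eventuallyEq ?_
    filter_upwards [hline.eventually hdiff] with s hs
    rw [(hasFDerivAt_space hs).fderiv]
    simp
  -- The derivative in position of `∂ₜ X = v ∘ X`.
  have h5 : HasFDerivAt (fun η => fderiv ℝ (Function.uncurry X) (t, η) (1, 0))
      ((fderiv ℝ (v t) (X t ξ)).comp (fderiv ℝ (X t) ξ)) ξ := by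
    have hXt := (hasFDerivAt_space hdiff.self_of_nhds).differentiableAt
    refine (hv.hasFDerivAt.comp ξ hXt.hasFDerivAt).congr_of_eventuallyEq ?_
    filter_upwards [hslice.eventually hdiff, hU.mem_nhds hξ] with η hη hηU
    exact (hasDerivAt_time hη).unique (hXv η hηU)
  have h6 : HasFDerivAt (fun η => fderiv ℝ (Function.uncurry X) (t, η) (1, 0))
      (((ContinuousLinearMap.apply ℝ E3 ((1 : ℝ), (0 : E3))).comp
        (fderiv ℝ (fderiv ℝ (Function.uncurry X)) (t, ξ))).comp
          (ContinuousLinearMap.inr ℝ ℝ E3)) ξ :=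
    ((ContinuousLinearMap.apply ℝ E3 ((1 : ℝ), (0 : E3))).hasFDerivAt.comp (t, ξ)
      hD.hasFDerivAt).comp ξ (hasFDerivAt_prodMk_right t ξ)
  have h7 : fderiv ℝ (v t) (X t ξ) (fderiv ℝ (X t) ξ a)
      = fderiv ℝ (fderiv ℝ (Function.uncurry X)) (t, ξ) (0, a) (1, 0) := by
    simpa using congrArg (fun L : E3 →L[ℝ] E3 => L a) (h5.unique h6)
  rw [h7, ← (hX.isSymmSndFDerivAt (by simp)).eq (1, 0) (0, a)]
  exact h1

/-- Euler's expansion formula `∂ₜ |J| = (div v) |J|`. -/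
theorem hasDerivAt_abs_det_flow {X v : ℝ → E3 → E3} {t : ℝ} {ξ : E3} {U : Set E3}
    (hU : IsOpen U) (hξ : ξ ∈ U) (hX : ContDiffAt ℝ 2 (Function.uncurry X) (t, ξ))
    (hXv : ∀ η ∈ U, HasDerivAt (fun s => X s η) (v t (X t η)) t)
    (hv : DifferentiableAt ℝ (v t) (X t ξ)) :
    HasDerivAt (fun s => |(fderiv ℝ (X s) ξ).det|)
      (divergence (v t) (X t ξ) * |(fderiv ℝ (X t) ξ).det|) t := by
  refine hasDerivAt_abs_of_hasDerivAt_mul ?_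
  rw [divergence_eq hv]
  exact hasDerivAt_det_of_hasDerivAt_comp (hasDerivAt_fderiv_flow hU hξ hX hXv hv)

/-! ### The transport theorem -/

/-- The transport theorem of Reynolds, in integrated form: the rate of change of the integral of `g`
over the moving domain is the integral of `D_t g + (div v) g`. -/
theorem integral_transport {G : Type*} [NormedAddCommGroup G] [NormedSpace ℝ G] [CompleteSpace G]
    {T : EReal} {Ω : ℝ → Set E3} {v : ℝ → E3 → E3} {g : ℝ → E3 → G}
    (hΩ₀ : IsOpen (Ω 0)) (hΩb : Bornology.IsBounded (Ω 0)) (hflow : IsFlowedBy T Ω v)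
    (hv : IsSmoothOnTube T Ω v) (hg : IsSmoothOnTube T Ω g)
    {t₁ t₂ : ℝ} (ht₁ : 0 < t₁) (ht : t₁ < t₂) (ht₂ : (t₂ : EReal) < T) :
    ∫ x in Ω t₂, g t₂ x = (∫ x in Ω t₁, g t₁ x) + ∫ τ in t₁..t₂, ∫ x in Ω τ,
      (materialDeriv v g τ x + divergence (v τ) x • g τ x) := by
  obtain ⟨X, hX, -, hXv, hXbij⟩ := hflow
  have hpos : ∀ τ ∈ Icc t₁ t₂, 0 < τ := fun τ hτ => ht₁.trans_le hτ.1
  have hltT : ∀ τ ∈ Icc t₁ t₂, (τ : EReal) < T := fun τ hτ =>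
    lt_of_le_of_lt (by exact_mod_cast hτ.2) ht₂
  have hcpt : IsCompact (closure (Ω 0)) := hΩb.isCompact_closure
  have hXτ : ∀ τ ∈ Icc t₁ t₂, ∀ ξ ∈ closure (Ω 0),
      ContDiffAt ℝ 2 (Function.uncurry X) (τ, ξ) := fun τ hτ ξ hξ =>
    hX τ (hpos τ hτ).le (hltT τ hτ) ξ hξ
  have hXd : ∀ τ ∈ Icc t₁ t₂, ∀ ξ ∈ closure (Ω 0),
      HasFDerivAt (X τ) (fderiv ℝ (X τ) ξ) ξ := fun τ hτ ξ hξ =>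
    (hasFDerivAt_space ((hXτ τ hτ ξ hξ).differentiableAt two_ne_zero)).differentiableAt.hasFDerivAt
  have hbij : ∀ τ ∈ Icc t₁ t₂, BijOn (X τ) (Ω 0) (Ω τ) := fun τ hτ =>
    hXbij τ (hpos τ hτ).le (hltT τ hτ)
  have hXcl : ∀ τ ∈ Icc t₁ t₂, ∀ ξ ∈ closure (Ω 0), X τ ξ ∈ closure (Ω τ) := fun τ hτ ξ hξ =>
    (hXd τ hτ ξ hξ).continuousAt.continuousWithinAt.mem_closure hξ (hbij τ hτ).mapsTo
  have hcov : ∀ τ ∈ Icc t₁ t₂, ∀ h : E3 → G,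
      ∫ x in Ω τ, h x = ∫ ξ in Ω 0, |(fderiv ℝ (X τ) ξ).det| • h (X τ ξ) := by
    intro τ hτ h
    rw [← (hbij τ hτ).image_eq]
    exact integral_image_eq_integral_abs_det_fderiv_smul volume hΩ₀.measurableSet
      (fun ξ hξ => (hXd τ hτ ξ (subset_closure hξ)).hasFDerivWithinAt) (hbij τ hτ).injOn h
  -- The integrand of the time derivative, written with total derivatives, is continuous.
  let H : ℝ × E3 → G := fun p => fderiv ℝ (Function.uncurry g) p (1, v p.1 p.2)
    + (∑ i, fderiv ℝ (Function.uncurry v) p (0, EuclideanSpace.single i 1) i)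
      • Function.uncurry g p
  have hHeq : ∀ τ ∈ Icc t₁ t₂, ∀ x ∈ closure (Ω τ),
      materialDeriv v g τ x + divergence (v τ) x • g τ x = H (τ, x) := by
    intro τ hτ x hx
    have hgx := (hg τ (hpos τ hτ) (hltT τ hτ) x hx).differentiableAt one_ne_zero
    have hvx := hasFDerivAt_space
      ((hv τ (hpos τ hτ) (hltT τ hτ) x hx).differentiableAt one_ne_zero)
    rw [materialDeriv_eq v hgx, divergence_eq hvx.differentiableAt, hvx.fderiv]
    simp [H]
  have hHc : ∀ τ ∈ Icc t₁ t₂, ∀ x ∈ closure (Ω τ), ContinuousAt H (τ, x) := by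
    intro τ hτ x hx
    have hgx := hg τ (hpos τ hτ) (hltT τ hτ) x hx
    have hvx := hv τ (hpos τ hτ) (hltT τ hτ) x hx
    refine ContinuousAt.add ?_ (ContinuousAt.smul ?_ hgx.continuousAt)
    · exact (hgx.continuousAt_fderiv one_ne_zero).clm_apply
        (continuousAt_const.prodMk hvx.continuousAt)
    · refine tendsto_finsetSum _ fun i _ => ?_
      exact (PiLp.proj (𝕜 := ℝ) 2 (fun _ : Fin 3 => ℝ) i).continuous.continuousAt.comp
        ((hvx.continuousAt_fderiv one_ne_zero).clm_apply continuousAt_const)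
  let Φ : E3 → ℝ → G := fun ξ τ => |(fderiv ℝ (X τ) ξ).det| • H (τ, X τ ξ)
  have hΦc : ContinuousOn (Function.uncurry Φ) (closure (Ω 0) ×ˢ Icc t₁ t₂) := by
    rintro ⟨ξ, τ⟩ ⟨hξ, hτ⟩
    refine ContinuousAt.continuousWithinAt ?_
    have hswap : ContinuousAt (fun p : E3 × ℝ => (p.2, p.1)) (ξ, τ) := by fun_prop
    have hC2 := hXτ τ hτ ξ hξ
    have hdet : ContinuousAt (fun p : E3 × ℝ => |(fderiv ℝ (X p.2) p.1).det|) (ξ, τ) := by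
      have h1 : ContinuousAt (fun p : E3 × ℝ => |((fderiv ℝ (Function.uncurry X) (p.2, p.1)).comp
          (ContinuousLinearMap.inr ℝ ℝ E3)).det|) (ξ, τ) := by
        refine ContinuousAt.abs (ContinuousLinearMap.continuous_det.continuousAt.comp ?_)
        exact ContinuousAt.clm_comp (ContinuousAt.comp (f := fun p : E3 × ℝ => (p.2, p.1))
          (g := fderiv ℝ (Function.uncurry X)) (hC2.continuousAt_fderiv two_ne_zero) hswap)
          continuousAt_const
      refine h1.congr ?_
      filter_upwards [hswap.eventually
        (eventually_differentiableAt_uncurry two_ne_zero (by simp) hC2)] with p hp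
      rw [(hasFDerivAt_space hp).fderiv]
    refine hdet.smul (ContinuousAt.comp (f := fun p : E3 × ℝ => (p.2, X p.2 p.1)) (g := H)
      (hHc τ hτ _ (hXcl τ hτ ξ hξ)) ?_)
    exact (continuousAt_snd).prodMk (ContinuousAt.comp (f := fun p : E3 × ℝ => (p.2, p.1))
      (g := Function.uncurry X) hC2.continuousAt hswap)
  -- The fundamental theorem of calculus along each orbit.
  have hftc : ∀ ξ ∈ Ω 0, ∫ τ in t₁..t₂, Φ ξ τ
      = |(fderiv ℝ (X t₂) ξ).det| • g t₂ (X t₂ ξ) - |(fderiv ℝ (X t₁) ξ).det| • g t₁ (X t₁ ξ) := by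
    intro ξ hξ
    have hξc := subset_closure hξ
    refine intervalIntegral.integral_eq_sub_of_hasDerivAt
      (f := fun τ => |(fderiv ℝ (X τ) ξ).det| • g τ (X τ ξ)) (fun τ hτ => ?_) ?_
    · rw [uIcc_of_le ht.le] at hτ
      have hx := hXcl τ hτ ξ hξc
      have hgx := (hg τ (hpos τ hτ) (hltT τ hτ) _ hx).differentiableAt one_ne_zero
      have hvx := (hv τ (hpos τ hτ) (hltT τ hτ) _ hx).differentiableAt one_ne_zero
      have hXvτ := hXv τ (hpos τ hτ) (hltT τ hτ)
      have h1 := hasDerivAt_abs_det_flow hΩ₀ hξ (hXτ τ hτ ξ hξc) hXvτ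
        (hasFDerivAt_space hvx).differentiableAt
      have h2 : HasDerivAt (fun s => g s (X s ξ)) (materialDeriv v g τ (X τ ξ)) τ := by
        rw [materialDeriv_eq v hgx]
        exact HasFDerivAt.comp_hasDerivAt τ (l := Function.uncurry g) (f := fun s => (s, X s ξ))
          hgx.hasFDerivAt ((hasDerivAt_id τ).prodMk (hXvτ ξ hξ))
      refine (h1.fun_smul h2).congr_deriv ?_
      simp only [Φ]
      rw [← hHeq τ hτ _ hx, smul_add, smul_smul, mul_comm (divergence _ _)]
    · refine ContinuousOn.intervalIntegrable ?_
      rw [uIcc_of_le ht.le]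
      exact hΦc.comp (f := fun τ => (ξ, τ)) (by fun_prop) fun τ hτ => ⟨hξc, hτ⟩
  have hint : ∀ τ ∈ Icc t₁ t₂,
      IntegrableOn (fun ξ => |(fderiv ℝ (X τ) ξ).det| • g τ (X τ ξ)) (Ω 0) := by
    intro τ hτ
    refine (ContinuousOn.integrableOn_compact hcpt fun ξ hξ => ?_).mono_set subset_closure
    refine ContinuousAt.continuousWithinAt (ContinuousAt.smul ?_ ?_)
    · have hC2 : ContDiffAt ℝ 2 (X τ) ξ :=
        ContDiffAt.comp (g := Function.uncurry X) (f := fun η => (τ, η)) ξ (hXτ τ hτ ξ hξ)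
          (contDiffAt_const.prodMk contDiffAt_id)
      exact (ContinuousLinearMap.continuous_det.continuousAt.comp
        (hC2.continuousAt_fderiv two_ne_zero)).abs
    · exact ContinuousAt.comp (f := X τ) (g := g τ)
        (hasFDerivAt_space ((hg τ (hpos τ hτ) (hltT τ hτ) _ (hXcl τ hτ ξ hξ)).differentiableAt
          one_ne_zero)).continuousAt (hXd τ hτ ξ hξ).continuousAt
  have h1 : t₁ ∈ Icc t₁ t₂ := ⟨le_rfl, ht.le⟩
  have h2 : t₂ ∈ Icc t₁ t₂ := ⟨ht.le, le_rfl⟩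
  have hprod : Integrable (Function.uncurry Φ)
      ((volume.restrict (Ω 0)).prod (volume.restrict (Ioc t₁ t₂))) := by
    rw [Measure.prod_restrict]
    exact (hΦc.integrableOn_compact (hcpt.prod isCompact_Icc)).mono_set
      (prod_mono subset_closure Ioc_subset_Icc_self)
  have hmain : ∫ ξ in Ω 0, ∫ τ in t₁..t₂, Φ ξ τ
      = ∫ τ in t₁..t₂, ∫ x in Ω τ, (materialDeriv v g τ x + divergence (v τ) x • g τ x) := by
    simp only [intervalIntegral.integral_of_le ht.le]
    rw [integral_integral_swap hprod]
    refine setIntegral_congr_fun measurableSet_Ioc fun τ hτ => ?_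
    have hτ' := Ioc_subset_Icc_self hτ
    rw [hcov τ hτ']
    refine setIntegral_congr_fun hΩ₀.measurableSet fun ξ hξ => ?_
    simp only [Φ]
    rw [← hHeq τ hτ' _ (hXcl τ hτ' ξ (subset_closure hξ))]
  rw [← hmain, setIntegral_congr_fun hΩ₀.measurableSet hftc, integral_sub (hint t₂ h2) (hint t₁ h1),
    ← hcov t₂ h2, ← hcov t₁ h1]
  abel

/-! ### Vector calculus identities -/

section Calculus

variable {f g : E3 → ℝ} {x : E3} {i j : Fin 3}

theorem pderiv_add (hf : DifferentiableAt ℝ f x) (hg : DifferentiableAt ℝ g x) :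
    pderiv i (fun y => f y + g y) x = pderiv i f x + pderiv i g x := by
  simp [pderiv, fderiv_fun_add hf hg]

theorem pderiv_sub (hf : DifferentiableAt ℝ f x) (hg : DifferentiableAt ℝ g x) :
    pderiv i (fun y => f y - g y) x = pderiv i f x - pderiv i g x := by
  simp [pderiv, fderiv_fun_sub hf hg]

theorem pderiv_mul (hf : DifferentiableAt ℝ f x) (hg : DifferentiableAt ℝ g x) :
    pderiv i (fun y => f y * g y) x = pderiv i f x * g x + f x * pderiv i g x := by
  simp [pderiv, fderiv_fun_mul hf hg]
  ring

theorem pderiv_mul_const (hf : DifferentiableAt ℝ f x) (c : ℝ) :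
    pderiv i (fun y => f y * c) x = pderiv i f x * c := by
  rw [pderiv_mul hf (differentiableAt_const c)]
  simp [pderiv]

theorem pderiv_sum {ι : Type*} (s : Finset ι) {F : ι → E3 → ℝ}
    (hF : ∀ k ∈ s, DifferentiableAt ℝ (F k) x) :
    pderiv i (fun y => ∑ k ∈ s, F k y) x = ∑ k ∈ s, pderiv i (F k) x := by
  simp [pderiv, fderiv_fun_sum hF]

theorem differentiableAt_coord (i : Fin 3) : DifferentiableAt ℝ (fun y : E3 => y i) x :=
  (PiLp.proj (𝕜 := ℝ) 2 (fun _ : Fin 3 => ℝ) i).differentiableAt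

theorem pderiv_coord : pderiv i (fun y => y j) x = if j = i then 1 else 0 := by
  have h := pderiv_apply (u := fun y => y) (x := x) differentiableAt_id j i
  rw [h, fderiv_fun_id]
  simp

theorem pderiv_comm (hf : ContDiffAt ℝ 2 f x) :
    pderiv i (pderiv j f) x = pderiv j (pderiv i f) x := by
  have hD : DifferentiableAt ℝ (fderiv ℝ f) x :=
    (hf.fderiv_right (m := 1) (by norm_num)).differentiableAt one_ne_zero
  have h : ∀ k l : Fin 3, pderiv k (pderiv l f) x
      = fderiv ℝ (fderiv ℝ f) x (EuclideanSpace.single k 1) (EuclideanSpace.single l 1) := by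
    intro k l
    have := (hD.hasFDerivAt.clm_apply
      (hasFDerivAt_const (EuclideanSpace.single l (1 : ℝ)) x)).fderiv
    unfold pderiv
    rw [this]
    simp
  rw [h, h, (hf.isSymmSndFDerivAt (by simp)).eq]

theorem contDiffAt_pderiv (hf : ContDiffAt ℝ 2 f x) : ContDiffAt ℝ 1 (pderiv i f) x :=
  (hf.fderiv_right (m := 1) (by norm_num)).clm_apply contDiffAt_const

theorem inner_gradient (a : E3) : inner ℝ (gradient f x) a = fderiv ℝ f x a := by
  rw [gradient, InnerProductSpace.toDual_symm_apply]

theorem gradient_apply : gradient f x i = pderiv i f x := by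
  have h := inner_gradient (f := f) (x := x) (EuclideanSpace.single i 1)
  rw [EuclideanSpace.inner_single_right] at h
  simpa [pderiv] using h

end Calculus

theorem divergence_add {u w : E3 → E3} {x : E3} (hu : DifferentiableAt ℝ u x)
    (hw : DifferentiableAt ℝ w x) :
    divergence (fun y => u y + w y) x = divergence u x + divergence w x := by
  rw [divergence_eq (hu.fun_add hw), divergence_eq hu, divergence_eq hw, ← Finset.sum_add_distrib,
    fderiv_fun_add hu hw]
  simp

theorem inner_eq_sum (a b : E3) : inner ℝ a b = ∑ i, a i * b i := by
  simp [PiLp.inner_apply, mul_comm]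

theorem differentiableAt_coord_comp {u : E3 → E3} {x : E3} (hu : DifferentiableAt ℝ u x)
    (i : Fin 3) : DifferentiableAt ℝ (fun y => u y i) x :=
  differentiableAt_euclidean.1 hu i

theorem matrixDivergence_sub_smul_one {M : E3 → Matrix (Fin 3) (Fin 3) ℝ} {p : E3 → ℝ} {x : E3}
    (hM : ∀ i j, DifferentiableAt ℝ (fun y => M y i j) x) (hp : DifferentiableAt ℝ p x) :
    matrixDivergence (fun y => M y - p y • (1 : Matrix (Fin 3) (Fin 3) ℝ)) x
      = matrixDivergence M x - gradient p x := by
  ext i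
  have h : ∀ j, pderiv j (fun y => (M y - p y • (1 : Matrix (Fin 3) (Fin 3) ℝ)) i j) x
      = pderiv j (fun y => M y i j) x - pderiv j p x * (1 : Matrix (Fin 3) (Fin 3) ℝ) i j := by
    intro j
    rw [← pderiv_mul_const hp, ← pderiv_sub (hM i j) (hp.mul_const _)]
    rfl
  change ∑ j, pderiv j (fun y => (M y - p y • (1 : Matrix (Fin 3) (Fin 3) ℝ)) i j) x
    = (∑ j, pderiv j (fun y => M y i j) x) - gradient p x i
  rw [Finset.sum_congr rfl fun j _ => h j, Finset.sum_sub_distrib, gradient_apply]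
  simp [Matrix.one_apply]

/-- `div (ᵗM u) = (div M, u) + M : ∇u`. -/
theorem divergence_transpose_mulVec {M : E3 → Matrix (Fin 3) (Fin 3) ℝ} {u : E3 → E3} {x : E3}
    (hM : ∀ i j, DifferentiableAt ℝ (fun y => M y i j) x) (hu : DifferentiableAt ℝ u x) :
    divergence (fun y => applyMatrix (M y).transpose (u y)) x
      = inner ℝ (matrixDivergence M x) (u x)
        + ∑ i, ∑ j, M x i j * velocityGradient u x i j := by
  have h : ∀ j, pderiv j (fun y => applyMatrix (M y).transpose (u y) j) x
      = ∑ i, (pderiv j (fun y => M y i j) x * u x i + M x i j * velocityGradient u x i j) := by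
    intro j
    have e : (fun y => applyMatrix (M y).transpose (u y) j) = fun y => ∑ i, M y i j * u y i := by
      funext y
      simp [applyMatrix, Matrix.mulVec, dotProduct]
    rw [e, pderiv_sum _ fun i _ => (hM i j).fun_mul (differentiableAt_coord_comp hu i)]
    refine Finset.sum_congr rfl fun i _ => ?_
    rw [pderiv_mul (hM i j) (differentiableAt_coord_comp hu i)]
    rfl
  rw [divergence, Finset.sum_congr rfl fun j _ => h j, Finset.sum_comm, inner_eq_sum]
  simp only [matrixDivergence, Finset.sum_mul, Finset.sum_add_distrib]

theorem inner_applyMatrix_transpose (M : Matrix (Fin 3) (Fin 3) ℝ) (a b : E3) :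
    inner ℝ a (applyMatrix M.transpose b) = inner ℝ (applyMatrix M a) b := by
  simp only [inner_eq_sum, applyMatrix, Matrix.mulVec, dotProduct, Matrix.transpose_apply,
    Fin.sum_univ_three]
  ring

/-! ### The cross product -/

theorem cross_apply_zero (a b : E3) : cross a b 0 = a 1 * b 2 - a 2 * b 1 := by
  simp [cross, cross_apply]

theorem cross_apply_one (a b : E3) : cross a b 1 = a 2 * b 0 - a 0 * b 2 := by
  simp [cross, cross_apply]

theorem cross_apply_two (a b : E3) : cross a b 2 = a 0 * b 1 - a 1 * b 0 := by
  simp [cross, cross_apply]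

/-- The cross product as a continuous bilinear map. -/
noncomputable def crossBilin : E3 →L[ℝ] E3 →L[ℝ] E3 :=
  (LinearMap.mk₂ ℝ cross
    (fun a b c => by simp [cross])
    (fun r a b => by simp [cross])
    (fun a b c => by simp [cross])
    (fun r a b => by simp [cross])).toContinuousBilinearMap

theorem crossBilin_apply (a b : E3) : crossBilin a b = cross a b := rfl

theorem cross_self_smul (a : E3) (r : ℝ) : cross a (r • a) = 0 := by
  simp [cross]

/-- The matrix field `x × M`, whose `j`-th column at `x` is the cross product of the position `x`
with the `j`-th column of `M x`. -/
def crossMatrix (M : E3 → Matrix (Fin 3) (Fin 3) ℝ) (x : E3) : Matrix (Fin 3) (Fin 3) ℝ :=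
  Matrix.of fun i j => cross x (WithLp.toLp 2 fun k => M x k j) i

theorem applyMatrix_crossMatrix (M : E3 → Matrix (Fin 3) (Fin 3) ℝ) (x n : E3) :
    applyMatrix (crossMatrix M x) n = cross x (applyMatrix (M x) n) := by
  ext i
  fin_cases i <;>
  simp only [Fin.mk_one, Fin.zero_eta, Fin.reduceFinMk, cross_apply_zero, cross_apply_one,
    cross_apply_two, applyMatrix, crossMatrix, Matrix.mulVec, dotProduct, Matrix.of_apply,
    Fin.sum_univ_three] <;> ring

theorem sum_pderiv_coord_mul_sub {A B : E3 → Fin 3 → ℝ} {x : E3}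
    (hA : ∀ l, DifferentiableAt ℝ (fun y => A y l) x)
    (hB : ∀ l, DifferentiableAt ℝ (fun y => B y l) x) (i j : Fin 3) :
    ∑ l, pderiv l (fun y => y i * A y l - y j * B y l) x
      = (A x i - B x j) + (x i * ∑ l, pderiv l (fun y => A y l) x
          - x j * ∑ l, pderiv l (fun y => B y l) x) := by
  have h : ∀ l, pderiv l (fun y => y i * A y l - y j * B y l) x
      = ((if i = l then 1 else 0) * A x l + x i * pderiv l (fun y => A y l) x)
        - ((if j = l then 1 else 0) * B x l + x j * pderiv l (fun y => B y l) x) := by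
    intro l
    rw [pderiv_sub ((differentiableAt_coord i).fun_mul (hA l))
      ((differentiableAt_coord j).fun_mul (hB l)),
      pderiv_mul (differentiableAt_coord i) (hA l), pderiv_mul (differentiableAt_coord j) (hB l),
      pderiv_coord, pderiv_coord]
  simp only [h, Finset.sum_sub_distrib, Finset.sum_add_distrib, ite_mul, one_mul, zero_mul,
    Finset.sum_ite_eq, Finset.mem_univ, if_true, ← Finset.mul_sum]
  ring

/-- For a symmetric matrix field the divergence commutes with `x ×`: the antisymmetric part, which
the derivatives of the coordinates produce, vanishes. -/
theorem matrixDivergence_crossMatrix {M : E3 → Matrix (Fin 3) (Fin 3) ℝ} {x : E3}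
    (hM : ∀ i j, DifferentiableAt ℝ (fun y => M y i j) x) (hsymm : ∀ i j, M x i j = M x j i) :
    matrixDivergence (crossMatrix M) x = cross x (matrixDivergence M x) := by
  ext i
  fin_cases i
  · have h := sum_pderiv_coord_mul_sub (A := fun y l => M y 2 l) (B := fun y l => M y 1 l)
      (fun l => hM 2 l) (fun l => hM 1 l) 1 2
    simp only [hsymm 2 1, sub_self, zero_add] at h
    simpa [cross_apply_zero, matrixDivergence, crossMatrix] using h
  · have h := sum_pderiv_coord_mul_sub (A := fun y l => M y 0 l) (B := fun y l => M y 2 l)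
      (fun l => hM 0 l) (fun l => hM 2 l) 2 0
    simp only [hsymm 0 2, sub_self, zero_add] at h
    simpa [cross_apply_one, matrixDivergence, crossMatrix] using h
  · have h := sum_pderiv_coord_mul_sub (A := fun y l => M y 1 l) (B := fun y l => M y 0 l)
      (fun l => hM 1 l) (fun l => hM 0 l) 0 1
    simp only [hsymm 1 0, sub_self, zero_add] at h
    simpa [cross_apply_two, matrixDivergence, crossMatrix] using h

/-! ### Material derivatives of products -/

theorem materialDeriv_bilin {G₁ G₂ G : Type*} [NormedAddCommGroup G₁] [NormedSpace ℝ G₁]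
    [NormedAddCommGroup G₂] [NormedSpace ℝ G₂] [NormedAddCommGroup G] [NormedSpace ℝ G]
    (B : G₁ →L[ℝ] G₂ →L[ℝ] G) (v : ℝ → E3 → E3) {a : ℝ → E3 → G₁} {b : ℝ → E3 → G₂} {t : ℝ}
    {x : E3} (ha : DifferentiableAt ℝ (Function.uncurry a) (t, x))
    (hb : DifferentiableAt ℝ (Function.uncurry b) (t, x)) :
    materialDeriv v (fun s y => B (a s y) (b s y)) t x
      = B (a t x) (materialDeriv v b t x) + B (materialDeriv v a t x) (b t x) := by
  have h := B.hasFDerivAt_of_bilinear ha.hasFDerivAt hb.hasFDerivAt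
  have h' : HasFDerivAt (Function.uncurry fun s y => B (a s y) (b s y)) _ (t, x) := h
  rw [materialDeriv_eq v h'.differentiableAt, materialDeriv_eq v ha, materialDeriv_eq v hb,
    h'.fderiv]
  simp [Function.uncurry]

theorem materialDeriv_add {G : Type*} [NormedAddCommGroup G] [NormedSpace ℝ G]
    (v : ℝ → E3 → E3) {a b : ℝ → E3 → G} {t : ℝ} {x : E3}
    (ha : DifferentiableAt ℝ (Function.uncurry a) (t, x))
    (hb : DifferentiableAt ℝ (Function.uncurry b) (t, x)) :
    materialDeriv v (fun s y => a s y + b s y) t x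
      = materialDeriv v a t x + materialDeriv v b t x := by
  have h : HasFDerivAt (Function.uncurry fun s y => a s y + b s y) _ (t, x) :=
    ha.hasFDerivAt.add hb.hasFDerivAt
  rw [materialDeriv_eq v h.differentiableAt, materialDeriv_eq v ha, materialDeriv_eq v hb,
    h.fderiv]
  rfl

theorem materialDeriv_position (v : ℝ → E3 → E3) (t : ℝ) (x : E3) :
    materialDeriv v (fun _ y => y) t x = v t x := by
  simp [materialDeriv]

/-! ### The stress tensors -/

section Stress

variable (E : EnergyDensities) (u : E3 → E3) (p : E3 → ℝ) (μ : ℝ) (x : E3)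

theorem divergence_eq_trace : divergence u x = (velocityGradient u x).trace := rfl

theorem stress_eq_sub : stress E u p
    = fun y => stress E u (fun _ => 0) y - p y • (1 : Matrix (Fin 3) (Fin 3) ℝ) := by
  funext y
  simp [stress]

/-- `S : ∇u` is the dissipation minus the work of the pressure. -/
theorem sum_stress_mul_velocityGradient :
    ∑ i, ∑ j, stress E u p x i j * velocityGradient u x i j
      = dissipation E u x - divergence u x * p x := by
  have h₁ : ∑ i, ∑ j, strainRate u x i j * velocityGradient u x i j
      = matrixNormSq (strainRate u x) := by
    simp only [matrixNormSq, strainRate, Fin.sum_univ_three, Matrix.smul_apply, Matrix.add_apply,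
      Matrix.transpose_apply, smul_eq_mul]
    ring
  have h₂ : ∑ i, ∑ j, (1 : Matrix (Fin 3) (Fin 3) ℝ) i j * velocityGradient u x i j
      = divergence u x := by
    simp [divergence_eq_trace, Matrix.trace, Matrix.one_apply]
  have h₃ : ∑ i, ∑ j, vorticity u x i j * velocityGradient u x i j
      = matrixNormSq (vorticity u x) := by
    simp only [matrixNormSq, vorticity, Fin.sum_univ_three, Matrix.smul_apply, Matrix.sub_apply,
      Matrix.transpose_apply, smul_eq_mul]
    ring
  have e : ∀ i j, stress E u p x i j * velocityGradient u x i j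
      = deriv E.e₁ (matrixNormSq (strainRate u x))
          * (strainRate u x i j * velocityGradient u x i j)
        + (deriv E.e₂ (|divergence u x| ^ 2) * divergence u x - p x)
          * ((1 : Matrix (Fin 3) (Fin 3) ℝ) i j * velocityGradient u x i j)
        + deriv E.e₃ (matrixNormSq (vorticity u x))
          * (vorticity u x i j * velocityGradient u x i j) := by
    intro i j
    simp only [stress, Matrix.sub_apply, Matrix.add_apply, Matrix.smul_apply, smul_eq_mul]
    ring
  simp only [e, Finset.sum_add_distrib, ← Finset.mul_sum, h₁, h₂, h₃, dissipation, sq_abs]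
  ring

theorem modifiedStress_symm (i j : Fin 3) :
    modifiedStress E μ u p x i j = modifiedStress E μ u p x j i := by
  have h : strainRate u x i j = strainRate u x j i := by
    simp [strainRate, add_comm]
  have h1 : (1 : Matrix (Fin 3) (Fin 3) ℝ) i j = (1 : Matrix (Fin 3) (Fin 3) ℝ) j i := by
    simp [Matrix.one_apply, eq_comm]
  simp only [modifiedStress, Matrix.sub_apply, Matrix.add_apply, Matrix.smul_apply, h, h1]

theorem deriv_eq_of_eq_mul_on_nonneg {e : ℝ → ℝ} {r : ℝ} (he : DifferentiableAt ℝ e r)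
    (h : ∀ s, 0 ≤ s → e s = μ * s) (hr : 0 ≤ r) : deriv e r = μ := by
  have h1 : HasDerivWithinAt e (deriv e r) (Ici 0) r := he.hasDerivAt.hasDerivWithinAt
  have h2 : HasDerivWithinAt e μ (Ici 0) r := by
    have h3 : HasDerivWithinAt (fun s => μ * s) μ (Ici 0) r := by
      simpa using ((hasDerivAt_id r).const_mul μ).hasDerivWithinAt
    exact h3.congr (fun s hs => h s hs) (h r hr)
  exact (uniqueDiffOn_Ici 0 r hr).eq_deriv _ h1 h2

/-- If `e₃` is linear, the stress tensors differ by a multiple of `ᵗ(∇u) - (div u) I`. -/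
theorem modifiedStress_apply_eq {E : EnergyDensities} {μ : ℝ}
    (h₃ : ∀ r : ℝ, 0 ≤ r → E.e₃ r = μ * r) (i j : Fin 3) :
    modifiedStress E μ u p x i j = stress E u p x i j
      + (velocityGradient u x j i * μ
        - divergence u x * (μ * (1 : Matrix (Fin 3) (Fin 3) ℝ) i j)) := by
  have hr : 0 ≤ matrixNormSq (vorticity u x) :=
    Finset.sum_nonneg fun i _ => Finset.sum_nonneg fun j _ => mul_self_nonneg _
  have hd := deriv_eq_of_eq_mul_on_nonneg μ
    (E.contDiff₃.differentiable one_ne_zero (matrixNormSq (vorticity u x))) h₃ hr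
  have hD : strainRate u x i j
      = 1 / 2 * (velocityGradient u x i j + velocityGradient u x j i) := rfl
  have hW : vorticity u x i j
      = 1 / 2 * (velocityGradient u x i j - velocityGradient u x j i) := rfl
  simp only [modifiedStress, stress, hd, Matrix.sub_apply, Matrix.add_apply, Matrix.smul_apply,
    smul_eq_mul]
  rw [hD, hW]
  ring

variable {x}

/-- `ᵗ(∇u) - (div u) I` is divergence free, so that the two stress tensors exert the same force. -/
theorem matrixDivergence_modifiedStress {E : EnergyDensities} {u : E3 → E3} {p : E3 → ℝ} {μ : ℝ}
    (h₃ : ∀ r : ℝ, 0 ≤ r → E.e₃ r = μ * r) (hu : ContDiffAt ℝ 2 u x)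
    (hS : ∀ i j, DifferentiableAt ℝ (fun y => stress E u p y i j) x) :
    matrixDivergence (modifiedStress E μ u p) x = matrixDivergence (stress E u p) x := by
  have hui : ∀ i, ContDiffAt ℝ 2 (fun y => u y i) x := fun i => contDiffAt_euclidean.1 hu i
  have hG : ∀ i j, DifferentiableAt ℝ (fun y => velocityGradient u y i j) x := fun i j =>
    (contDiffAt_pderiv (hui i)).differentiableAt one_ne_zero
  have hdiv : DifferentiableAt ℝ (divergence u) x :=
    DifferentiableAt.fun_sum fun i _ => hG i i
  ext i
  have h : ∀ j, pderiv j (fun y => modifiedStress E μ u p y i j) x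
      = pderiv j (fun y => stress E u p y i j) x
        + (pderiv i (fun y => velocityGradient u y j j) x * μ
          - pderiv j (divergence u) x * (μ * (1 : Matrix (Fin 3) (Fin 3) ℝ) i j)) := by
    intro j
    simp only [modifiedStress_apply_eq u p _ h₃]
    rw [pderiv_add (hS i j) (((hG j i).mul_const _).fun_sub (hdiv.mul_const _)),
      pderiv_sub ((hG j i).mul_const _) (hdiv.mul_const _), pderiv_mul_const (hG j i),
      pderiv_mul_const hdiv]
    have hcomm : pderiv j (fun y => velocityGradient u y j i) x
        = pderiv i (fun y => velocityGradient u y j j) x := pderiv_comm (hui j)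
    rw [hcomm]
  have hsum : pderiv i (divergence u) x = ∑ j, pderiv i (fun y => velocityGradient u y j j) x :=
    pderiv_sum Finset.univ fun j _ => hG j j
  change ∑ j, pderiv j (fun y => modifiedStress E μ u p y i j) x
    = ∑ j, pderiv j (fun y => stress E u p y i j) x
  rw [Finset.sum_congr rfl fun j _ => h j, Finset.sum_add_distrib, Finset.sum_sub_distrib,
    ← Finset.sum_mul, ← hsum]
  simp [Matrix.one_apply]

end Stress

/-! ### Continuity up to the boundary -/

section Tube

variable {T : EReal} {Ω : ℝ → Set E3} {t : ℝ}

theorem IsSmoothOnTube.continuousOn {G : Type*} [NormedAddCommGroup G] [NormedSpace ℝ G]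
    {g : ℝ → E3 → G} (hg : IsSmoothOnTube T Ω g) (ht : 0 < t) (htT : (t : EReal) < T) :
    ContinuousOn (g t) (closure (Ω t)) := fun x hx =>
  (hasFDerivAt_space ((hg t ht htT x hx).differentiableAt
    one_ne_zero)).continuousAt.continuousWithinAt

theorem IsSmoothOnTube.contDiffAt {G : Type*} [NormedAddCommGroup G] [NormedSpace ℝ G]
    {g : ℝ → E3 → G} (hg : IsSmoothOnTube T Ω g) (ht : 0 < t) (htT : (t : EReal) < T) {x : E3}
    (hx : x ∈ closure (Ω t)) : ContDiffAt ℝ 1 (g t) x :=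
  ContDiffAt.comp (g := Function.uncurry g) (f := fun y => (t, y)) x (hg t ht htT x hx)
    (contDiffAt_const.prodMk contDiffAt_id)

theorem IsSmoothOnTube.differentiableAt {G : Type*} [NormedAddCommGroup G] [NormedSpace ℝ G]
    {g : ℝ → E3 → G} (hg : IsSmoothOnTube T Ω g) (ht : 0 < t) (htT : (t : EReal) < T) {x : E3}
    (hx : x ∈ closure (Ω t)) : DifferentiableAt ℝ (Function.uncurry g) (t, x) :=
  (hg t ht htT x hx).differentiableAt one_ne_zero

theorem IsSmoothOnTube.bilin {G₁ G₂ G : Type*} [NormedAddCommGroup G₁] [NormedSpace ℝ G₁]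
    [NormedAddCommGroup G₂] [NormedSpace ℝ G₂] [NormedAddCommGroup G] [NormedSpace ℝ G]
    (B : G₁ →L[ℝ] G₂ →L[ℝ] G) {a : ℝ → E3 → G₁} {b : ℝ → E3 → G₂}
    (ha : IsSmoothOnTube T Ω a) (hb : IsSmoothOnTube T Ω b) :
    IsSmoothOnTube T Ω fun s y => B (a s y) (b s y) := fun t ht htT x hx =>
  (B.contDiff.contDiffAt.comp (t, x) (ha t ht htT x hx)).clm_apply (hb t ht htT x hx)

theorem IsSmoothOnTube.continuousOn_fderiv {G : Type*} [NormedAddCommGroup G] [NormedSpace ℝ G]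
    {g : ℝ → E3 → G} (hg : IsSmoothOnTube T Ω g) (ht : 0 < t) (htT : (t : EReal) < T) :
    ContinuousOn (fun x => fderiv ℝ (g t) x) (closure (Ω t)) := fun _ hx =>
  ((hg.contDiffAt ht htT hx).continuousAt_fderiv one_ne_zero).continuousWithinAt

theorem IsSmoothOnTube.continuousOn_gradient {g : ℝ → E3 → ℝ} (hg : IsSmoothOnTube T Ω g)
    (ht : 0 < t) (htT : (t : EReal) < T) :
    ContinuousOn (fun x => gradient (g t) x) (closure (Ω t)) :=
  (InnerProductSpace.toDual ℝ E3).symm.continuous.comp_continuousOn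
    (hg.continuousOn_fderiv ht htT)

theorem IsSmoothOnTube.continuousOn_velocityGradient {v : ℝ → E3 → E3}
    (hv : IsSmoothOnTube T Ω v) (ht : 0 < t) (htT : (t : EReal) < T) :
    ContinuousOn (velocityGradient (v t)) (closure (Ω t)) := by
  refine continuousOn_pi.2 fun i => continuousOn_pi.2 fun j => ?_
  have h : ContinuousOn (fun x => fderiv ℝ (v t) x (EuclideanSpace.single j 1) i)
      (closure (Ω t)) :=
    (PiLp.proj (𝕜 := ℝ) 2 (fun _ : Fin 3 => ℝ) i).continuous.comp_continuousOn
      ((hv.continuousOn_fderiv ht htT).clm_apply continuousOn_const)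
  refine h.congr fun x hx => ?_
  exact pderiv_apply ((hv.contDiffAt ht htT hx).differentiableAt one_ne_zero) i j

theorem IsSmoothOnTube.continuousOn_materialDeriv {G : Type*} [NormedAddCommGroup G]
    [NormedSpace ℝ G] {v : ℝ → E3 → E3} {g : ℝ → E3 → G} (hv : IsSmoothOnTube T Ω v)
    (hg : IsSmoothOnTube T Ω g) (ht : 0 < t) (htT : (t : EReal) < T) :
    ContinuousOn (materialDeriv v g t) (closure (Ω t)) := by
  have h : ContinuousOn (fun x => fderiv ℝ (Function.uncurry g) (t, x) (1, v t x))
      (closure (Ω t)) := by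
    intro x hx
    refine ContinuousAt.continuousWithinAt (ContinuousAt.clm_apply ?_ ?_)
    · exact ContinuousAt.comp (f := fun y => (t, y)) (g := fderiv ℝ (Function.uncurry g))
        ((hg t ht htT x hx).continuousAt_fderiv one_ne_zero) (by fun_prop)
    · exact continuousAt_const.prodMk (hv.contDiffAt ht htT hx).continuousAt
  exact h.congr fun x hx => materialDeriv_eq v (hg.differentiableAt ht htT hx)

theorem IsSmoothOnTube.continuousOn_divergence {v : ℝ → E3 → E3}
    (hv : IsSmoothOnTube T Ω v) (ht : 0 < t) (htT : (t : EReal) < T) :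
    ContinuousOn (divergence (v t)) (closure (Ω t)) :=
  (continuous_id.matrix_trace (n := Fin 3) (R := ℝ)).comp_continuousOn
    (hv.continuousOn_velocityGradient ht htT)

theorem IsSmoothOnTube.continuousOn_stress (E : EnergyDensities) {v : ℝ → E3 → E3}
    {σ : ℝ → E3 → ℝ} (hv : IsSmoothOnTube T Ω v) (hσ : IsSmoothOnTube T Ω σ)
    (ht : 0 < t) (htT : (t : EReal) < T) :
    ContinuousOn (stress E (v t) (σ t)) (closure (Ω t)) := by
  have h₁ := E.contDiff₁.continuous_deriv le_rfl
  have h₂ := E.contDiff₂.continuous_deriv le_rfl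
  have h₃ := E.contDiff₃.continuous_deriv le_rfl
  have hD : ContinuousOn (strainRate (v t)) (closure (Ω t)) :=
    (by fun_prop : Continuous fun G : Matrix (Fin 3) (Fin 3) ℝ =>
      (1 / 2 : ℝ) • (G + G.transpose)).comp_continuousOn (hv.continuousOn_velocityGradient ht htT)
  have hW : ContinuousOn (vorticity (v t)) (closure (Ω t)) :=
    (by fun_prop : Continuous fun G : Matrix (Fin 3) (Fin 3) ℝ =>
      (1 / 2 : ℝ) • (G - G.transpose)).comp_continuousOn (hv.continuousOn_velocityGradient ht htT)
  have hN : Continuous matrixNormSq := by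
    unfold matrixNormSq
    exact continuous_finsetSum _ fun i _ => continuous_finsetSum _ fun j _ =>
      (continuous_id.matrix_elem i j).mul (continuous_id.matrix_elem i j)
  have hdiv := hv.continuousOn_divergence ht htT
  exact ((((h₁.comp_continuousOn (hN.comp_continuousOn hD)).smul hD).add
    (((h₂.comp_continuousOn (hdiv.abs.pow 2)).mul hdiv).smul continuousOn_const)).add
    ((h₃.comp_continuousOn (hN.comp_continuousOn hW)).smul hW)).sub
    ((hσ.continuousOn ht htT).smul continuousOn_const)

theorem IsSmoothOnTube.continuousOn_modifiedStress (E : EnergyDensities) (μ : ℝ)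
    {v : ℝ → E3 → E3} {σ : ℝ → E3 → ℝ} (hv : IsSmoothOnTube T Ω v) (hσ : IsSmoothOnTube T Ω σ)
    (h₃ : ∀ r : ℝ, 0 ≤ r → E.e₃ r = μ * r) (ht : 0 < t) (htT : (t : EReal) < T) :
    ContinuousOn (modifiedStress E μ (v t) (σ t)) (closure (Ω t)) := by
  refine continuousOn_pi.2 fun i => continuousOn_pi.2 fun j => ?_
  simp only [modifiedStress_apply_eq _ _ _ h₃]
  have hG := hv.continuousOn_velocityGradient ht htT
  have hS := hv.continuousOn_stress E hσ ht htT
  exact ((continuousOn_pi.1 (continuousOn_pi.1 hS i)) j).add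
    ((((continuousOn_pi.1 (continuousOn_pi.1 hG j)) i).mul continuousOn_const).sub
      ((hv.continuousOn_divergence ht htT).mul continuousOn_const))

theorem IsSmoothOnTube.continuousOn_flux {a : ℝ → ℝ} (ha : ContDiff ℝ 1 a) {g : ℝ → E3 → ℝ}
    (hg : IsSmoothOnTube T Ω g) (ht : 0 < t) (htT : (t : EReal) < T) :
    ContinuousOn (flux a (g t)) (closure (Ω t)) :=
  ((ha.continuous_deriv le_rfl).comp_continuousOn
    ((hg.continuousOn_gradient ht htT).norm.pow 2)).smul (hg.continuousOn_gradient ht htT)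

end Tube

/-! ### Balance laws -/

/-- If `D_t g + (div v) g = D + h`, where `D` integrates to zero over the domain as soon as it is
bounded, then the integral of `g` changes by the integral of `h`. The equation itself
bounds `D`, since all its other terms are continuous up to the boundary. -/
theorem integral_balance {G : Type*} [NormedAddCommGroup G] [NormedSpace ℝ G] [CompleteSpace G]
    {T : EReal} (hT : 0 < T) {Ω : ℝ → Set E3}
    (hΩ : ∀ t : ℝ, 0 ≤ t → (t : EReal) < T → IsBoundedDomainOfClassTwo (Ω t))
    {v : ℝ → E3 → E3} {g D h : ℝ → E3 → G} (hflow : IsFlowedBy T Ω v)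
    (hv : IsSmoothOnTube T Ω v) (hg : IsSmoothOnTube T Ω g)
    (hh : ∀ t : ℝ, 0 < t → (t : EReal) < T → ContinuousOn (h t) (closure (Ω t)))
    (hbal : ∀ t : ℝ, 0 < t → (t : EReal) < T → ∀ x ∈ Ω t,
      materialDeriv v g t x + divergence (v t) x • g t x = D t x + h t x)
    (hD : ∀ t : ℝ, 0 < t → (t : EReal) < T → ∀ M : ℝ, (∀ x ∈ Ω t, ‖D t x‖ ≤ M) →
      ∫ x in Ω t, D t x = 0)
    {t₁ t₂ : ℝ} (ht₁ : 0 < t₁) (ht : t₁ < t₂) (ht₂ : (t₂ : EReal) < T) :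
    ∫ x in Ω t₂, g t₂ x = (∫ x in Ω t₁, g t₁ x) + ∫ τ in t₁..t₂, ∫ x in Ω τ, h τ x := by
  have h0 := hΩ 0 le_rfl (by exact_mod_cast hT)
  rw [integral_transport h0.isOpen h0.isBounded hflow hv hg ht₁ ht ht₂]
  congr 1
  refine intervalIntegral.integral_congr fun τ hτ => ?_
  rw [uIcc_of_le ht.le] at hτ
  have hτ0 : 0 < τ := ht₁.trans_le hτ.1
  have hτT : (τ : EReal) < T := lt_of_le_of_lt (by exact_mod_cast hτ.2) ht₂
  have hdom := hΩ τ hτ0.le hτT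
  have hcpt : IsCompact (closure (Ω τ)) := hdom.isBounded.isCompact_closure
  have hLc : ContinuousOn (fun x => materialDeriv v g τ x + divergence (v τ) x • g τ x)
      (closure (Ω τ)) :=
    (hv.continuousOn_materialDeriv hg hτ0 hτT).add
      ((hv.continuousOn_divergence hτ0 hτT).smul (hg.continuousOn hτ0 hτT))
  have hDeq : ∀ x ∈ Ω τ,
      D τ x = (materialDeriv v g τ x + divergence (v τ) x • g τ x) - h τ x := fun x hx => by
    rw [hbal τ hτ0 hτT x hx, add_sub_cancel_right]
  have hDc := hLc.sub (hh τ hτ0 hτT)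
  obtain ⟨M, hM⟩ := hcpt.exists_bound_of_continuousOn hDc
  have hDint : IntegrableOn (D τ) (Ω τ) :=
    (integrableOn_congr_fun hDeq hdom.isOpen.measurableSet).2
      ((hDc.integrableOn_compact hcpt).mono_set subset_closure)
  have hhint : IntegrableOn (h τ) (Ω τ) :=
    ((hh τ hτ0 hτT).integrableOn_compact hcpt).mono_set subset_closure
  rw [setIntegral_congr_fun hdom.isOpen.measurableSet (hbal τ hτ0 hτT),
    integral_add hDint hhint, hD τ hτ0 hτT M fun x hx => ?_, zero_add]
  rw [hDeq x hx]
  exact hM x (subset_closure hx)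

/-- The divergence theorem for a matrix field without normal component on the boundary. -/
theorem setIntegral_matrixDivergence_eq_zero {Ω : Set E3} (h : IsBoundedDomainOfClassTwo Ω)
    {S : E3 → Matrix (Fin 3) (Fin 3) ℝ} {M : ℝ}
    (hS : ∀ i j, ContDiffOn ℝ 1 (fun y => S y i j) Ω) (hSc : ContinuousOn S (closure Ω))
    (hM : ∀ x ∈ Ω, ‖matrixDivergence S x‖ ≤ M)
    (hn : ∀ x n, IsUnitOuterNormal Ω x n → applyMatrix (S x) n = 0) :
    ∫ x in Ω, matrixDivergence S x = 0 := by
  have hrow : ∀ i, ContDiffOn ℝ 1 (fun y => (WithLp.toLp 2 (S y i) : E3)) Ω := fun i =>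
    contDiffOn_euclidean.2 fun j => hS i j
  have hrowdiv : ∀ i, ∀ x ∈ Ω, ‖divergence (fun y => WithLp.toLp 2 (S y i)) x‖ ≤ M :=
    fun i x hx => (PiLp.norm_apply_le (matrixDivergence S x) i).trans (hM x hx)
  have hzero : ∀ i, ∫ x in Ω, divergence (fun y => WithLp.toLp 2 (S y i)) x = 0 := by
    intro i
    refine setIntegral_divergence_eq_zero h (hrow i) ?_ (hrowdiv i) fun x n hxn => ?_
    · exact (PiLp.continuous_toLp 2 (fun _ : Fin 3 => ℝ)).comp_continuousOn
        (continuousOn_pi.1 hSc i)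
    · have h0 := congrArg (fun a : E3 => a i) (hn x n hxn)
      simp only [applyMatrix, Matrix.mulVec, dotProduct, PiLp.zero_apply] at h0
      rw [inner_eq_sum, ← h0]
      exact Finset.sum_congr rfl fun j _ => mul_comm _ _
  have hint : IntegrableOn (matrixDivergence S) Ω := by
    refine integrableOn_of_continuousOn_of_bounded h.isOpen h.isBounded.measure_lt_top.ne ?_ hM
    exact (PiLp.continuous_toLp 2 (fun _ : Fin 3 => ℝ)).comp_continuousOn
      (continuousOn_pi.2 fun i => continuousOn_divergence h.isOpen (hrow i))
  ext i
  have hcomm := (PiLp.proj (𝕜 := ℝ) 2 (fun _ : Fin 3 => ℝ) i).integral_comp_comm hint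
  exact hcomm.symm.trans (hzero i)

section Fluid

variable {T : EReal} {Ω : ℝ → Set E3} {E : EnergyDensities} {f : FluidFields} {t : ℝ} {x : E3}

theorem IsClassical.contDiffAt_stress (hs : IsClassical T Ω E f) (ht : 0 < t)
    (htT : (t : EReal) < T) (hx : x ∈ Ω t) (i j : Fin 3) :
    ContDiffAt ℝ 1 (fun y => stress E (f.v t) (f.σ t) y i j) x := by
  rw [stress_eq_sub]
  exact (hs.stress_space t ht htT x hx i j).sub
    ((hs.σ_smooth.contDiffAt ht htT (subset_closure hx)).smul contDiffAt_const)

theorem IsClassical.contDiffAt_modifiedStress (hs : IsClassical T Ω E f) {μ : ℝ}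
    (h₃ : ∀ r : ℝ, 0 ≤ r → E.e₃ r = μ * r) (ht : 0 < t)
    (htT : (t : EReal) < T) (hx : x ∈ Ω t) (i j : Fin 3) :
    ContDiffAt ℝ 1 (fun y => modifiedStress E μ (f.v t) (f.σ t) y i j) x := by
  simp only [modifiedStress_apply_eq _ _ _ h₃]
  have hG : ∀ k l, ContDiffAt ℝ 1 (fun y => velocityGradient (f.v t) y k l) x := fun k l =>
    contDiffAt_pderiv (contDiffAt_euclidean.1 (hs.v_space t ht htT x hx) k)
  have hdiv : ContDiffAt ℝ 1 (divergence (f.v t)) x :=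
    ContDiffAt.sum fun k _ => hG k k
  exact (hs.contDiffAt_stress ht htT hx i j).add
    (((hG j i).mul contDiffAt_const).sub (hdiv.mul contDiffAt_const))

theorem momentum_density_smooth (hs : IsClassical T Ω E f) :
    IsSmoothOnTube T Ω fun t x => f.ρ t x • f.v t x :=
  hs.ρ_smooth.bilin (ContinuousLinearMap.lsmul ℝ ℝ) hs.v_smooth

theorem force_density_smooth (hs : IsClassical T Ω E f) :
    IsSmoothOnTube T Ω fun t x => f.ρ t x • f.F t x :=
  hs.ρ_smooth.bilin (ContinuousLinearMap.lsmul ℝ ℝ) hs.F_smooth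

/-- By conservation of mass, `D_t (ρ k) + (div v) ρ k = ρ D_t k`. -/
theorem materialDeriv_density_smul {G : Type*} [NormedAddCommGroup G] [NormedSpace ℝ G]
    (hs : IsClassical T Ω E f) (hsys : SolvesSystem T Ω E f) {k : ℝ → E3 → G}
    (hk : DifferentiableAt ℝ (Function.uncurry k) (t, x))
    (ht : 0 < t) (htT : (t : EReal) < T) (hx : x ∈ Ω t) :
    materialDeriv f.v (fun s y => f.ρ s y • k s y) t x
      + divergence (f.v t) x • (f.ρ t x • k t x) = f.ρ t x • materialDeriv f.v k t x := by
  have h := materialDeriv_bilin (ContinuousLinearMap.lsmul ℝ ℝ) f.v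
    (hs.ρ_smooth.differentiableAt ht htT (subset_closure hx)) hk
  simp only [ContinuousLinearMap.lsmul_apply] at h
  rw [h, add_assoc, smul_smul, ← add_smul, hsys.mass t ht htT x hx, zero_smul, add_zero]

theorem momentum_balance (hs : IsClassical T Ω E f) (hsys : SolvesSystem T Ω E f)
    (ht : 0 < t) (htT : (t : EReal) < T) (hx : x ∈ Ω t) :
    materialDeriv f.v (fun s y => f.ρ s y • f.v s y) t x
      + divergence (f.v t) x • (f.ρ t x • f.v t x)
      = matrixDivergence (stress E (f.v t) (f.σ t)) x + f.ρ t x • f.F t x := by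
  have hx' := subset_closure hx
  rw [materialDeriv_density_smul hs hsys (hs.v_smooth.differentiableAt ht htT hx') ht htT hx,
    stress_eq_sub, matrixDivergence_sub_smul_one
      (fun i j => (hs.stress_space t ht htT x hx i j).differentiableAt one_ne_zero)
      ((hs.σ_smooth.contDiffAt ht htT hx').differentiableAt one_ne_zero),
    sub_add_eq_add_sub, ← hsys.momentum t ht htT x hx, add_sub_cancel_right]

/-- The flux of the total energy, `ᵗS(v, σ) v + q_θ`. -/
noncomputable def energyFlux (E : EnergyDensities) (f : FluidFields) (t : ℝ) (x : E3) : E3 :=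
  applyMatrix (stress E (f.v t) (f.σ t) x).transpose (f.v t x) + flux E.e₄ (f.θ t) x

theorem contDiffAt_applyMatrix_transpose {S : E3 → Matrix (Fin 3) (Fin 3) ℝ} {u : E3 → E3}
    (hS : ∀ i j, ContDiffAt ℝ 1 (fun y => S y i j) x) (hu : ContDiffAt ℝ 1 u x) :
    ContDiffAt ℝ 1 (fun y => applyMatrix (S y).transpose (u y)) x :=
  contDiffAt_euclidean.2 fun j => ContDiffAt.sum (s := Finset.univ)
    (f := fun i y => S y i j * u y i) fun i _ => (hS i j).mul (contDiffAt_euclidean.1 hu i)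

theorem totalEnergy_eq (f : FluidFields) :
    totalEnergy f = fun s y => f.ρ s y • ((1 / 2 : ℝ) • inner ℝ (f.v s y) (f.v s y) + f.e s y) := by
  funext s y
  simp only [totalEnergy, real_inner_self_eq_norm_sq, smul_eq_mul]
  ring

theorem energy_density_smooth (hs : IsClassical T Ω E f) :
    IsSmoothOnTube T Ω fun s y => (1 / 2 : ℝ) • inner ℝ (f.v s y) (f.v s y) + f.e s y :=
  fun t ht htT x hx =>
    (((hs.v_smooth t ht htT x hx).inner ℝ (hs.v_smooth t ht htT x hx)).const_smul (1 / 2 : ℝ)).add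
      (hs.e_smooth t ht htT x hx)

theorem energy_balance (hs : IsClassical T Ω E f) (hsys : SolvesSystem T Ω E f)
    (ht : 0 < t) (htT : (t : EReal) < T) (hx : x ∈ Ω t) :
    materialDeriv f.v (totalEnergy f) t x + divergence (f.v t) x • totalEnergy f t x
      = divergence (energyFlux E f t) x + f.ρ t x * inner ℝ (f.F t x) (f.v t x) := by
  have hx' := subset_closure hx
  have hv := hs.v_smooth.differentiableAt ht htT hx'
  have he := hs.e_smooth.differentiableAt ht htT hx'
  have hvx := hs.v_smooth.contDiffAt ht htT hx'
  have hS := hs.contDiffAt_stress ht htT hx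
  -- The material derivative of the specific energy.
  have hk : materialDeriv f.v
      (fun s y => (1 / 2 : ℝ) • inner ℝ (f.v s y) (f.v s y) + f.e s y) t x
      = inner ℝ (f.v t x) (materialDeriv f.v f.v t x) + materialDeriv f.v f.e t x := by
    have h1 := materialDeriv_bilin ((1 / 2 : ℝ) • innerSL ℝ) f.v hv hv
    have h2 : DifferentiableAt ℝ
        (Function.uncurry fun s y => (1 / 2 : ℝ) • inner ℝ (f.v s y) (f.v s y)) (t, x) :=
      (hv.inner ℝ hv).const_smul (1 / 2 : ℝ)
    rw [materialDeriv_add f.v h2 he]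
    change materialDeriv f.v (fun s y => (1 / 2 : ℝ) • inner ℝ (f.v s y) (f.v s y)) t x
      = (1 / 2 : ℝ) • inner ℝ (f.v t x) (materialDeriv f.v f.v t x)
        + (1 / 2 : ℝ) • inner ℝ (materialDeriv f.v f.v t x) (f.v t x) at h1
    rw [h1, real_inner_comm (f.v t x) (materialDeriv f.v f.v t x)]
    simp only [smul_eq_mul]
    ring
  -- The momentum equation, tested with the velocity.
  have hm := congrArg (fun a => inner ℝ a (f.v t x)) (momentum_balance hs hsys ht htT hx)
  rw [materialDeriv_density_smul hs hsys hv ht htT hx] at hm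
  simp only [inner_add_left, real_inner_smul_left] at hm
  have hdiv : divergence (energyFlux E f t) x
      = inner ℝ (matrixDivergence (stress E (f.v t) (f.σ t)) x) (f.v t x)
        + (dissipation E (f.v t) x - divergence (f.v t) x * f.σ t x)
        + divergence (flux E.e₄ (f.θ t)) x := by
    unfold energyFlux
    rw [divergence_add
      ((contDiffAt_applyMatrix_transpose hS hvx).differentiableAt one_ne_zero)
      ((hs.heatFlux_space t ht htT x hx).differentiableAt one_ne_zero),
      divergence_transpose_mulVec (fun i j => (hS i j).differentiableAt one_ne_zero)
        (hvx.differentiableAt one_ne_zero),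
      sum_stress_mul_velocityGradient]
  have hen := hsys.energy t ht htT x hx
  rw [totalEnergy_eq, materialDeriv_density_smul hs hsys
    ((energy_density_smooth hs).differentiableAt ht htT hx') ht htT hx, hk, hdiv, smul_eq_mul,
    mul_add, real_inner_comm (materialDeriv f.v f.v t x) (f.v t x)]
  linarith

theorem angular_momentum_balance (hs : IsClassical T Ω E f) (hsys : SolvesSystem T Ω E f) {μ : ℝ}
    (h₃ : ∀ r : ℝ, 0 ≤ r → E.e₃ r = μ * r)
    (ht : 0 < t) (htT : (t : EReal) < T) (hx : x ∈ Ω t) :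
    materialDeriv f.v (fun s y => cross y (f.ρ s y • f.v s y)) t x
      + divergence (f.v t) x • cross x (f.ρ t x • f.v t x)
      = matrixDivergence (crossMatrix (modifiedStress E μ (f.v t) (f.σ t))) x
        + cross x (f.ρ t x • f.F t x) := by
  have hx' := subset_closure hx
  have hpos : DifferentiableAt ℝ (Function.uncurry fun (_ : ℝ) (y : E3) => y) (t, x) :=
    differentiableAt_snd
  have h := materialDeriv_bilin crossBilin f.v hpos
    ((momentum_density_smooth hs).differentiableAt ht htT hx')
  simp only [crossBilin_apply, materialDeriv_position, cross_self_smul, add_zero] at h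
  rw [h, matrixDivergence_crossMatrix
    (fun i j => (hs.contDiffAt_modifiedStress h₃ ht htT hx i j).differentiableAt one_ne_zero)
    (modifiedStress_symm E _ _ μ x),
    matrixDivergence_modifiedStress h₃ (hs.v_space t ht htT x hx)
      (fun i j => (hs.contDiffAt_stress ht htT hx i j).differentiableAt one_ne_zero)]
  simp only [← crossBilin_apply]
  rw [← map_smul, ← map_add, momentum_balance hs hsys ht htT hx, map_add]

end Fluid

end NonNewtonianFluid

theorem theorem2p8 (T : EReal) (hT : 0 < T) (Ω : ℝ → Set E3)
    (hΩ : ∀ t : ℝ, 0 ≤ t → (t : EReal) < T → IsBoundedDomainOfClassTwo (Ω t))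
    (E : EnergyDensities) (f : FluidFields)
    (hsmooth : IsClassical T Ω E f)
    (hflow : IsFlowedBy T Ω f.v)
    (hsystem : SolvesSystem T Ω E f) :
    -- part (i): momentum, total energy, concentration
    ((∀ t : ℝ, 0 < t → (t : EReal) < T → ∀ x n : E3, IsUnitOuterNormal (Ω t) x n →
        deriv E.e₄ (‖gradient (f.θ t) x‖ ^ 2) * inner ℝ n (gradient (f.θ t) x) = 0 ∧
        deriv E.e₅ (‖gradient (f.C t) x‖ ^ 2) * inner ℝ n (gradient (f.C t) x) = 0 ∧
        applyMatrix (stress E (f.v t) (f.σ t) x) n = 0) →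
      ∀ t₁ t₂ : ℝ, 0 < t₁ → t₁ < t₂ → (t₂ : EReal) < T →
        (∫ x in Ω t₂, f.ρ t₂ x • f.v t₂ x
          = (∫ x in Ω t₁, f.ρ t₁ x • f.v t₁ x)
            + ∫ τ in t₁..t₂, ∫ x in Ω τ, f.ρ τ x • f.F τ x) ∧
        (∫ x in Ω t₂, totalEnergy f t₂ x
          = (∫ x in Ω t₁, totalEnergy f t₁ x)
            + ∫ τ in t₁..t₂, ∫ x in Ω τ, f.ρ τ x * inner ℝ (f.F τ x) (f.v τ x)) ∧
        (∫ x in Ω t₂, f.C t₂ x = ∫ x in Ω t₁, f.C t₁ x)) ∧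
    -- part (ii): angular momentum
    (∀ μ₃ : ℝ, (∀ r : ℝ, 0 ≤ r → E.e₃ r = μ₃ * r) →
      (∀ t : ℝ, 0 < t → (t : EReal) < T → ∀ x n : E3, IsUnitOuterNormal (Ω t) x n →
        applyMatrix (modifiedStress E μ₃ (f.v t) (f.σ t) x) n = 0) →
      ∀ t₁ t₂ : ℝ, 0 < t₁ → t₁ < t₂ → (t₂ : EReal) < T →
        ∫ x in Ω t₂, cross x (f.ρ t₂ x • f.v t₂ x)
          = (∫ x in Ω t₁, cross x (f.ρ t₁ x • f.v t₁ x))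
            + ∫ τ in t₁..t₂, ∫ x in Ω τ, cross x (f.ρ τ x • f.F τ x)) := by
  have hv := hsmooth.v_smooth
  have hstress := fun t ht htT => hv.continuousOn_stress E hsmooth.σ_smooth (t := t) ht htT
  refine ⟨fun hbc t₁ t₂ ht₁ ht ht₂ => ⟨?_, ?_, ?_⟩, fun μ₃ h₃ hbc t₁ t₂ ht₁ ht ht₂ => ?_⟩
  · refine integral_balance hT hΩ hflow hv (momentum_density_smooth hsmooth)
      (D := fun t => matrixDivergence (stress E (f.v t) (f.σ t)))
      (h := fun t x => f.ρ t x • f.F t x)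
      (fun t ht htT => (force_density_smooth hsmooth).continuousOn ht htT)
      (fun t ht htT x hx => momentum_balance hsmooth hsystem ht htT hx)
      (fun t ht htT M hM => ?_) ht₁ ht ht₂
    exact setIntegral_matrixDivergence_eq_zero (hΩ t ht.le htT)
      (fun i j x hx => (hsmooth.contDiffAt_stress ht htT hx i j).contDiffWithinAt)
      (hstress t ht htT) hM fun x n hxn => (hbc t ht htT x n hxn).2.2
  · refine integral_balance hT hΩ hflow hv (g := totalEnergy f)
      (D := fun t => divergence (energyFlux E f t))
      (h := fun t x => f.ρ t x * inner ℝ (f.F t x) (f.v t x)) ?_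
      (fun t ht htT => (hsmooth.ρ_smooth.continuousOn ht htT).mul
        ((hsmooth.F_smooth.continuousOn ht htT).inner (𝕜 := ℝ) (hv.continuousOn ht htT)))
      (fun t ht htT x hx => energy_balance hsmooth hsystem ht htT hx)
      (fun t ht htT M hM => ?_) ht₁ ht ht₂
    · rw [totalEnergy_eq]
      exact hsmooth.ρ_smooth.bilin (ContinuousLinearMap.lsmul ℝ ℝ) (energy_density_smooth hsmooth)
    · refine setIntegral_divergence_eq_zero (hΩ t ht.le htT) (fun x hx => ?_) ?_ hM
        fun x n hxn => ?_
      · exact ((contDiffAt_applyMatrix_transpose (hsmooth.contDiffAt_stress ht htT hx)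
          (hv.contDiffAt ht htT (subset_closure hx))).add
            (hsmooth.heatFlux_space t ht htT x hx)).contDiffWithinAt
      · refine ContinuousOn.add ?_ (hsmooth.θ_smooth.continuousOn_flux E.contDiff₄ ht htT)
        refine (PiLp.continuous_toLp 2 (fun _ : Fin 3 => ℝ)).comp_continuousOn
          (continuousOn_pi.2 fun j => continuousOn_finsetSum Finset.univ
            (f := fun i y => stress E (f.v t) (f.σ t) y i j * f.v t y i) fun i _ => ?_)
        exact (continuousOn_pi.1 (continuousOn_pi.1 (hstress t ht htT) i) j).mul
          ((PiLp.proj (𝕜 := ℝ) 2 (fun _ : Fin 3 => ℝ) i).continuous.comp_continuousOn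
            (hv.continuousOn ht htT))
      · obtain ⟨h4, -, hS⟩ := hbc t ht htT x n hxn
        rw [energyFlux, inner_add_right, inner_applyMatrix_transpose, hS, inner_zero_left, zero_add,
          flux, real_inner_smul_right, h4]
  · have h := integral_balance hT hΩ hflow hv hsmooth.C_smooth
      (D := fun t => divergence (flux E.e₅ (f.C t))) (h := fun _ _ => (0 : ℝ))
      (fun t ht htT => continuousOn_const)
      (fun t ht htT x hx => by
        rw [add_zero, smul_eq_mul]
        exact hsystem.concentration t ht htT x hx)
      (fun t ht htT M hM => setIntegral_divergence_eq_zero (hΩ t ht.le htT)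
        (fun x hx => (hsmooth.generalFlux_space t ht htT x hx).contDiffWithinAt)
        (hsmooth.C_smooth.continuousOn_flux E.contDiff₅ ht htT) hM fun x n hxn => by
          rw [flux, real_inner_smul_right, (hbc t ht htT x n hxn).2.1]) ht₁ ht ht₂
    simpa using h
  · have hpos : IsSmoothOnTube T Ω fun (_ : ℝ) (y : E3) => y := fun _ _ _ _ _ => contDiffAt_snd
    refine integral_balance hT hΩ hflow hv
      (hpos.bilin crossBilin (momentum_density_smooth hsmooth))
      (D := fun t => matrixDivergence (crossMatrix (modifiedStress E μ₃ (f.v t) (f.σ t))))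
      (h := fun t x => cross x (f.ρ t x • f.F t x))
      (fun t ht htT => (hpos.bilin crossBilin (force_density_smooth hsmooth)).continuousOn ht htT)
      (fun t ht htT x hx => angular_momentum_balance hsmooth hsystem h₃ ht htT hx)
      (fun t ht htT M hM => ?_) ht₁ ht ht₂
    have hmod := hv.continuousOn_modifiedStress E μ₃ hsmooth.σ_smooth h₃ ht htT
    refine setIntegral_matrixDivergence_eq_zero (hΩ t ht.le htT) (fun i j x hx => ?_) ?_ hM
      fun x n hxn => ?_
    · have hcol : ContDiffAt ℝ 1 (fun y =>
          (WithLp.toLp 2 fun k => modifiedStress E μ₃ (f.v t) (f.σ t) y k j : E3)) x :=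
        contDiffAt_euclidean.2 fun k => hsmooth.contDiffAt_modifiedStress h₃ ht htT hx k j
      have hcross : ContDiffAt ℝ 1 (fun y => crossBilin y
          (WithLp.toLp 2 fun k => modifiedStress E μ₃ (f.v t) (f.σ t) y k j)) x :=
        crossBilin.contDiff.contDiffAt.clm_apply hcol
      exact (contDiffAt_euclidean.1 hcross i).contDiffWithinAt
    · refine continuousOn_pi.2 fun i => continuousOn_pi.2 fun j => ?_
      have hcol : ContinuousOn (fun y =>
          (WithLp.toLp 2 fun k => modifiedStress E μ₃ (f.v t) (f.σ t) y k j : E3))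
          (closure (Ω t)) :=
        (PiLp.continuous_toLp 2 (fun _ : Fin 3 => ℝ)).comp_continuousOn
          (continuousOn_pi.2 fun k => continuousOn_pi.1 (continuousOn_pi.1 hmod k) j)
      exact (PiLp.proj (𝕜 := ℝ) 2 (fun _ : Fin 3 => ℝ) i).continuous.comp_continuousOn
        (crossBilin.continuous.continuousOn.clm_apply hcol)
    · rw [applyMatrix_crossMatrix, hbc t ht htT x n hxn, ← crossBilin_apply, map_zero]
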